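/- Let $G$ be a finite group. For a projective resolution $P=(\cdots\to P_1\to P_0\to\mathbb Z)$ of the trivial module $\mathbb Z$ over $\mathbb Z[G]$ put $P_{-1}=\mathbb Z$, $\Omega^0\mathbb Z=\mathbb Z$ and $\Omega^k\mathbb Z=\ker(P_{k-1}\to P_{k-2})$ for $k\ge 1$. Let $\widehat H^{-k}(G,\mathbb Z)=\underline{\mathrm{Hom}}_{\mathbb Z[G]}(\mathbb Z,\Omega^k\mathbb Z)$, the group of homomorphisms modulo those that factor through a projective module. The cup product $\widehat H^{-k}\times\widehat H^{-l}\to\widehat H^{-k-l}$ is $[f]\cup[g]=[\Psi^k(g)\circ f]$, where $\Psi^k(g):\Omega^k\mathbb Z\to\Omega^{k+l}\mathbb Z$ is obtained by lifting $g:\mathbb Z\to\Omega^l\mathbb Z$ successively along the exact sequences $0\to\Omega^{j+1}\mathbb Z\to P_j\to\Omega^j\mathbb Z\to 0$ and $0\to\Omega^{j+l+1}\mathbb Z\to P_{j+l}\to\Omega^{j+l}\mathbb Z\to 0$. With $N=\sum_{g\in G}g$, for each $k>0$ let $$\nu_k: H_k(G,\mathbb Z)=H_k(P\otimes_{\mathbb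 Z[G]}\mathbb Z)\to\widehat H^{-k-1}(G,\mathbb Z),\qquad [y\otimes 1]\mapsto[\,c\mapsto c\,Ny\,].$$ Then, for every $P$ and every $k>0$, $\nu_k$ is an isomorphism. For all $n,m>0$ there is a (necessarily unique) bilinear product $$H_n(G,\mathbb Z)\otimes H_m(G,\mathbb Z)\to H_{n+m+1}(G,\mathbb Z),\qquad a\otimes b\mapsto a\cdot b,$$ which satisfies $\nu_{n+m+1}(a\cdot b)=\nu_n(a)\cup\nu_m(b)$ for every $P$. This product has the following description. Let $EG$ be a contractible space with a free action of $G$ by homeomorphisms, for example a contractible free $G$-CW complex. For such a space $X$, say that a $G$-invariant singular cycle $z\in C_k(X)$ (with $k>0$) represents $c\in H_k(G,\mathbb Z)$ if for every $P$ the $\mathbb Z[G]$-linear chain maps $\varphi:C_*(X)\to P$ over $\mathrm{id}_{\mathbb Z}$ exist and each of them satisfies $[\,c'\mapsto c'\varphi(z)\,]=\nu_k(c)$ in $\widehat H^{-k-1}(G,\mathbb Z)$. 1. For every $k>0$, each invariant cycle in $C_k(EG)$ represents exactly one class in $H_k(G,\mathbb Z)$, each class in $H_k(G,\mathbb Z)$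 is represented by an invariant cycle in $C_k(EG)$, and two invariant cycles represent the same class if and only if they differ by the boundary of an invariant chain. 2. The join $EG*EG$ (the quotient of $EG\times EG\times[0,1]$ by $(x,y,0)\sim(x,y',0)$ and $(x,y,1)\sim(x',y,1)$) with the action $g(x,y,t)=(gx,gy,t)$ is contractible and the action is free. 3. If invariant cycles $x\in C_n(EG)$ and $y\in C_m(EG)$ represent $a$ and $b$, then the join $x*y\in C_{n+m+1}(EG*EG)$ is an invariant cycle and represents $a\cdot b$. Here $x*y$ is the bilinear extension of the join of singular simplices $(\sigma*\tau)((1-t)u,tv)=(\sigma(u),\tau(v),t)$, where $u\in\Delta^n$, $v\in\Delta^m$, $t\in[0,1]$ and $\Delta^{n+m+1}=\Delta^n*\Delta^m$. -/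

import Mathlib

open CategoryTheory CategoryTheory.Limits ZeroObject

noncomputable section

namespace TateJoin

universe u v

/-! ### Stable morphisms -/

section Stable

variable {C : Type u} [Category.{v} C] [Abelian C]

/-- The morphisms `X ⟶ Y` which factor through a projective object. -/
def PHom (X Y : C) : AddSubgroup (X ⟶ Y) where
  carrier := {f | ∃ (Q : C) (_ : Projective Q) (a : X ⟶ Q) (b : Q ⟶ Y), a ≫ b = f}
  zero_mem' := ⟨0, inferInstance, 0, 0, by simp⟩
  add_mem' := by
    rintro f g ⟨Q, hQ, a, b, rfl⟩ ⟨Q', hQ', a', b', rfl⟩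
    exact ⟨Q ⊞ Q', inferInstance, biprod.lift a a', biprod.desc b b', by simp⟩
  neg_mem' := by
    rintro f ⟨Q, hQ, a, b, rfl⟩
    exact ⟨Q, hQ, -a, b, by simp⟩

/-- Morphisms in the stable category: morphisms modulo those factoring through a projective. -/
abbrev StableHom (X Y : C) : Type v := (X ⟶ Y) ⧸ PHom X Y

/-- The stable class of a morphism. -/
def StableHom.mk {X Y : C} (f : X ⟶ Y) : StableHom X Y := QuotientAddGroup.mk f

/-- Composition of stable morphisms, `[f], [g] ↦ [f ≫ g]` (that is, `[g ∘ f]`). -/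
def StableHom.comp {X Y Z : C} : StableHom X Y →+ StableHom Y Z →+ StableHom X Z :=
  QuotientAddGroup.lift _
    { toFun := fun f => QuotientAddGroup.map (PHom Y Z) (PHom X Z)
        (AddMonoidHom.mk' (fun g => f ≫ g) (fun _ _ => Preadditive.comp_add _ _ _ _ _ _)) (by
          rintro _ ⟨Q, hQ, a, b, rfl⟩
          exact ⟨Q, hQ, f ≫ a, b, by simp⟩)
      map_zero' := by
        ext g
        simp
      map_add' := fun f f' => by
        ext g
        simp } (by
    rintro _ ⟨Q, hQ, a, b, rfl⟩
    rw [AddMonoidHom.mem_ker]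
    ext g
    exact (QuotientAddGroup.eq_zero_iff _).2 ⟨Q, hQ, a, b ≫ g, by simp⟩)

lemma StableHom.comp_mk {X Y Z : C} (f : X ⟶ Y) (g : Y ⟶ Z) :
    StableHom.comp (StableHom.mk f) (StableHom.mk g) = StableHom.mk (f ≫ g) := rfl

section Loop

variable {S T : ShortComplex C} (hT : T.ShortExact) [Projective S.X₂]

/-- A lift of `f : S.X₃ ⟶ T.X₃` to the middle terms. -/
def midLift (f : S.X₃ ⟶ T.X₃) : S.X₂ ⟶ T.X₂ :=
  haveI := hT.epi_g
  Projective.factorThru (S.g ≫ f) T.g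

lemma midLift_g (f : S.X₃ ⟶ T.X₃) : midLift hT f ≫ T.g = S.g ≫ f :=
  haveI := hT.epi_g
  Projective.factorThru_comp _ _

/-- The map on kernels induced by the chosen lift of `f` to the middle terms. -/
def kerMap (f : S.X₃ ⟶ T.X₃) : S.X₁ ⟶ T.X₁ :=
  haveI := hT.mono_f
  hT.exact.lift (S.f ≫ midLift hT f) (by
    rw [Category.assoc, midLift_g, S.zero_assoc, zero_comp])

lemma kerMap_f (f : S.X₃ ⟶ T.X₃) : kerMap hT f ≫ T.f = S.f ≫ midLift hT f :=
  haveI := hT.mono_f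
  hT.exact.lift_f _ _

lemma kernel_mem_PHom (hT : T.ShortExact) {f : S.X₃ ⟶ T.X₃} (hf : f ∈ PHom S.X₃ T.X₃) {F : S.X₂ ⟶ T.X₂}
    (hF : F ≫ T.g = S.g ≫ f) {K : S.X₁ ⟶ T.X₁} (hK : K ≫ T.f = S.f ≫ F) :
    K ∈ PHom S.X₁ T.X₁ := by
  have := hT.mono_f
  have := hT.epi_g
  obtain ⟨Q, hQ, a, b, rfl⟩ := hf
  have h : (F - S.g ≫ a ≫ Projective.factorThru b T.g) ≫ T.g = 0 := by
    simp [hF]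
  refine ⟨S.X₂, inferInstance, S.f, hT.exact.lift _ h, ?_⟩
  rw [← cancel_mono T.f, Category.assoc, hT.exact.lift_f, hK]
  simp

/-- The map `Ψ` on stable morphisms: for short exact sequences `0 ⟶ ΩM ⟶ P ⟶ M ⟶ 0` and
`0 ⟶ ΩN ⟶ Q ⟶ N ⟶ 0` with `P` projective, a morphism `M ⟶ N` is lifted to `P ⟶ Q` and
restricted to `ΩM ⟶ ΩN`. The stable class of the result does not depend on the lift. -/
def loop : StableHom S.X₃ T.X₃ →+ StableHom S.X₁ T.X₁ :=
  QuotientAddGroup.lift (PHom S.X₃ T.X₃)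
    (AddMonoidHom.mk' (fun f => StableHom.mk (kerMap hT f)) (fun f g => by
      refine Eq.symm ((QuotientAddGroup.eq (s := PHom S.X₁ T.X₁)).2 ?_)
      refine kernel_mem_PHom hT (f := 0) (zero_mem _)
        (F := -(midLift hT f + midLift hT g) + midLift hT (f + g)) ?_ ?_
      · simp [midLift_g]
      · simp [kerMap_f])) (fun f hf =>
    (QuotientAddGroup.eq_zero_iff _).2 (kernel_mem_PHom hT hf (midLift_g hT f) (kerMap_f hT f)))

end Loop

end Stable

/-! ### Syzygies of a projective resolution -/

section Resolution

variable {C : Type u} [Category.{v} C] [Abelian C] {Z : C} (P : ProjectiveResolution Z)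

/-- The augmentation `P₀ ⟶ Z`. -/
def augmentation : P.complex.X 0 ⟶ Z := P.π.f 0

/-- The augmented complex `⋯ ⟶ P₁ ⟶ P₀ ⟶ Z`, indexed so that `Z` sits in degree `0` and `Pₖ` in
degree `k + 1`. -/
def augmented : ChainComplex C ℕ :=
  ChainComplex.augment P.complex (augmentation P) P.complex_d_comp_π_f_zero

/-- The syzygy `Ωᵏ Z = ker (Pₖ₋₁ ⟶ Pₖ₋₂)`, with `P₋₁ = Z` and `Ω⁰ Z = ker (Z ⟶ 0)`. -/
abbrev Omega (k : ℕ) : C := (augmented P).cycles k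

lemma augmented_exactAt (k : ℕ) : (augmented P).ExactAt k := by
  match k with
  | 0 =>
    rw [HomologicalComplex.exactAt_iff' _ 1 0 0 (by simp) (by simp)]
    rw [ShortComplex.exact_iff_epi _ ((augmented P).shape 0 0 (by simp))]
    exact inferInstanceAs (Epi (P.π.f 0))
  | 1 =>
    rw [HomologicalComplex.exactAt_iff' _ 2 1 0 (by simp) (by simp)]
    exact P.exact₀
  | n + 2 =>
    rw [HomologicalComplex.exactAt_iff' _ (n + 3) (n + 2) (n + 1) (by simp) (by simp)]
    exact P.exact_succ n

/-- The sequence `0 ⟶ Ωᵏ⁺¹ Z ⟶ Pₖ ⟶ Ωᵏ Z ⟶ 0`. -/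
def syzygySeq (k : ℕ) : ShortComplex C where
  X₁ := Omega P (k + 1)
  X₂ := (augmented P).X (k + 1)
  X₃ := Omega P k
  f := (augmented P).iCycles (k + 1)
  g := (augmented P).toCycles (k + 1) k
  zero := by
    rw [← cancel_mono ((augmented P).iCycles k)]
    simp

lemma syzygySeq_shortExact (k : ℕ) : (syzygySeq P k).ShortExact := by
  have : Epi ((augmented P).toCycles (k + 1) k) := by
    refine Preadditive.epi_of_isZero_cokernel' _
      ((augmented P).homologyIsCokernel (k + 1) k (by simp)) ?_
    exact ((augmented P).exactAt_iff_isZero_homology k).1 (augmented_exactAt P k)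
  have : Mono (syzygySeq P k).f := inferInstanceAs (Mono ((augmented P).iCycles (k + 1)))
  refine ShortComplex.ShortExact.mk' ?_ this ‹_›
  · refine ShortComplex.exact_of_f_is_kernel _ ?_
    refine KernelFork.IsLimit.ofι' _ _ (fun {A} x hx => ⟨(augmented P).liftCycles x k (by simp) ?_, ?_⟩)
    · have key : ∀ y : A ⟶ (augmented P).X (k + 1), y ≫ (augmented P).toCycles (k + 1) k = 0 →
          y ≫ (augmented P).d (k + 1) k = 0 := fun y hy => by
        rw [← HomologicalComplex.toCycles_i, ← Category.assoc, hy, zero_comp]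
      exact key x hx
    · exact (augmented P).liftCycles_i _ _ _ _

instance (k : ℕ) : Projective (syzygySeq P k).X₂ := P.projective k

/-- `Ĥ⁻ᵏ = Hom(Z, Ωᵏ Z)` (stable morphisms), computed with the resolution `P`. -/
abbrev TateNeg (k : ℕ) : Type v := StableHom Z (Omega P k)

/-- The iterate `Ψⁿ : Hom(Z, Ωᵐ Z) ⟶ Hom(Ωⁿ Z, Ωᵐ⁺ⁿ Z)` on stable morphisms (for `n = 0` it is the
identity, up to the identification `Ω⁰ Z = Z`). -/
def loopPow (m : ℕ) : (n : ℕ) → (TateNeg P m →+ StableHom (Omega P n) (Omega P (m + n)))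
  | 0 => StableHom.comp (StableHom.mk ((augmented P).iCycles 0))
  | n + 1 => (loop (S := syzygySeq P n) (T := syzygySeq P (m + n))
      (syzygySeq_shortExact P (m + n))).comp (loopPow m n)

/-- The cup product `Ĥ⁻ⁿ × Ĥ⁻ᵐ ⟶ Ĥ⁻ⁿ⁻ᵐ`, given by composition: `[f] ∪ [g] = [Ψⁿ g ∘ f]`. -/
def cup {n m j : ℕ} (h : n + m = j) : TateNeg P n →+ TateNeg P m →+ TateNeg P j :=
  AddMonoidHom.mk' (fun f =>
    ((StableHom.comp.flip (StableHom.mk (eqToHom (by rw [← h, Nat.add_comm])))).comp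
      (StableHom.comp f)).comp (loopPow P m n)) (fun f f' => by
    ext g
    simp)

end Resolution


/-! ### Group homology and negative Tate cohomology

This part is written over a commutative ring `k` of coefficients; it is used for `k = ℤ`. -/

section Group

variable {k G : Type} [CommRing k] [Group G]

/-- The homomorphism `k ⟶ A`, `c ↦ c • x`, for an invariant element `x`. -/
def pointHom {A : Rep k G} (x : A) (hx : ∀ g, A.ρ g x = x) : Rep.trivial k G k ⟶ A :=
  Rep.ofHom ⟨LinearMap.toSpanSingleton k A x, fun g => by ext; simp [hx]⟩

lemma pointHom_apply {A : Rep k G} (x : A) (hx : ∀ g, A.ρ g x = x) (c : k) :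
    (pointHom x hx).hom c = c • x := rfl

lemma hom_ext_one {A : Rep k G} {f f' : Rep.trivial k G k ⟶ A}
    (h : f.hom (1 : k) = f'.hom (1 : k)) : f = f' := by
  refine Rep.hom_ext (Representation.IntertwiningMap.ext (LinearMap.ext fun c => ?_))
  have hc : ∀ f : Rep.trivial k G k ⟶ A, f.hom c = c • f.hom (1 : k) := fun f => by
    rw [← map_smul, smul_eq_mul, mul_one]
  exact (hc f).trans ((congrArg (c • ·) h).trans (hc f').symm)

variable (P : ProjectiveResolution (Rep.trivial k G k))

lemma pointHom_add {A : Rep k G} {w x y : A} (h : w = x + y) (hw : ∀ g, A.ρ g w = w)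
    (hx : ∀ g, A.ρ g x = x) (hy : ∀ g, A.ρ g y = y) :
    pointHom w hw = pointHom x hx + pointHom y hy := by
  refine hom_ext_one ?_
  change (1 : k) • w = (1 : k) • x + (1 : k) • y
  rw [h, smul_add]

lemma pointHom_comp_eq {A B : Rep k G} {x : A} {y : B} (hx : ∀ g, A.ρ g x = x)
    (hy : ∀ g, B.ρ g y = y) (f : A ⟶ B) (h : f.hom x = y) :
    pointHom x hx ≫ f = pointHom y hy := by
  refine hom_ext_one ?_
  change f.hom ((1 : k) • x) = (1 : k) • y
  rw [one_smul, one_smul, h]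

lemma pointHom_comp {A B : Rep k G} (x : A) (hx : ∀ g, A.ρ g x = x) (f : A ⟶ B)
    (hf : f.hom x = 0) : pointHom x hx ≫ f = 0 := by
  refine hom_ext_one ?_
  rw [Rep.hom_comp]
  change f.hom ((1 : k) • x) = 0
  rw [one_smul, hf]

/-- The class in `Ĥ⁻ⁿ⁻¹` of the homomorphism `c ↦ c • x` into `Ωⁿ⁺¹`, for an invariant element
`x ∈ Pₙ` in the kernel of the (augmented) boundary. -/
def cycleClass {n : ℕ} (x : P.complex.X n) (hx : ∀ g, (P.complex.X n).ρ g x = x)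
    (hd : ((augmented P).d (n + 1) n).hom x = 0) : TateNeg P (n + 1) :=
  StableHom.mk ((augmented P).liftCycles (i := n + 1)
    (pointHom (A := (augmented P).X (n + 1)) x hx) n (by simp) (pointHom_comp _ _ _ hd))

/-- The complex `(k ⊗ P)_G`, whose homology is the group homology. -/
abbrev coinvComplex : ChainComplex (ModuleCat k) ℕ :=
  P.complex.coinvariantsTensorObj (Rep.trivial k G k)

lemma homologyπ_surjective (n : ℕ) : Function.Surjective ((coinvComplex P).homologyπ n) :=
  (ModuleCat.epi_iff_surjective _).1 inferInstance

variable [Fintype G]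

/-- The norm `(k ⊗ A)_G ⟶ A`, `⟦c ⊗ y⟧ ↦ ∑ g, g • (c • y)`. -/
def coinvNorm (A : Rep k G) :
    ((Rep.coinvariantsTensor k G).obj (Rep.trivial k G k)).obj A →ₗ[k] A :=
  Representation.Coinvariants.lift ((Rep.trivial k G k).ρ.tprod A.ρ)
    (TensorProduct.lift ((LinearMap.lsmul k A).compr₂ A.ρ.norm)) (fun g => by
      ext a
      simp)

lemma coinvNorm_mk (A : Rep k G) (c : k) (y : A) :
    coinvNorm A (Rep.coinvariantsTensorMk (Rep.trivial k G k) A c y) = A.ρ.norm (c • y) := rfl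

lemma coinvNorm_invariant (A : Rep k G)
    (z : ((Rep.coinvariantsTensor k G).obj (Rep.trivial k G k)).obj A) (g : G) :
    A.ρ g (coinvNorm A z) = coinvNorm A z := by
  obtain ⟨t, rfl⟩ := Representation.Coinvariants.mk_surjective _ z
  induction t using TensorProduct.induction_on with
  | zero => simp
  | tmul c y => exact Representation.self_norm_apply _ _ _
  | add a b ha hb => rw [map_add, map_add, map_add, ha, hb]

lemma coinvNorm_naturality {A B : Rep k G} (f : A ⟶ B)
    (z : ((Rep.coinvariantsTensor k G).obj (Rep.trivial k G k)).obj A) :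
    f.hom (coinvNorm A z) =
      coinvNorm B ((((Rep.coinvariantsTensor k G).obj (Rep.trivial k G k)).map f).hom z) := by
  obtain ⟨t, rfl⟩ := Representation.Coinvariants.mk_surjective _ z
  induction t using TensorProduct.induction_on with
  | zero => simp
  | tmul c y =>
    change f.hom (A.ρ.norm (c • y)) = B.ρ.norm (c • f.hom y)
    simp [Representation.norm, Rep.hom_comm_apply]
  | add a b ha hb => simp only [map_add, ha, hb]

lemma d_coinvNorm {n : ℕ} (hn : 0 < n) (z : (coinvComplex P).cycles n) :
    ((augmented P).d (n + 1) n).hom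
      (coinvNorm (P.complex.X n) ((coinvComplex P).iCycles n z)) = 0 := by
  obtain ⟨m, rfl⟩ : ∃ m, n = m + 1 := ⟨n - 1, by omega⟩
  have h : ((coinvComplex P).d (m + 1) m).hom ((coinvComplex P).iCycles (m + 1) z) = 0 :=
    congr($((coinvComplex P).iCycles_d (m + 1) m) z)
  refine (coinvNorm_naturality (P.complex.d (m + 1) m) _).trans ?_
  refine (congrArg _ h).trans (map_zero _)

/-- The cycle `⟦1 ⊗ y⟧` of `(k ⊗ P)_G` is sent to the class of `c ↦ c • ∑ g, g • y`. -/
def cyclesToTate {n : ℕ} (hn : 0 < n) : (coinvComplex P).cycles n →+ TateNeg P (n + 1) :=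
  AddMonoidHom.mk' (fun z => cycleClass P (coinvNorm (P.complex.X n) ((coinvComplex P).iCycles n z))
    (coinvNorm_invariant _ _) (d_coinvNorm P hn z)) (fun z z' => by
      refine congrArg StableHom.mk ?_
      rw [← cancel_mono ((augmented P).iCycles (n + 1)), Preadditive.add_comp,
        HomologicalComplex.liftCycles_i, HomologicalComplex.liftCycles_i,
        HomologicalComplex.liftCycles_i]
      exact pointHom_add (by rw [map_add]; exact map_add _ _ _) _ _ _)

lemma cyclesToTate_ker {n : ℕ} (hn : 0 < n) :
    ((coinvComplex P).homologyπ n).hom.toAddMonoidHom.ker ≤ (cyclesToTate P hn).ker := by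
  intro z hz
  have hex := ShortComplex.exact_of_g_is_cokernel
    (ShortComplex.mk _ _ ((coinvComplex P).toCycles_comp_homologyπ (n + 1) n))
    ((coinvComplex P).homologyIsCokernel (n + 1) n (by simp))
  obtain ⟨w, hw⟩ := (ShortComplex.moduleCat_exact_iff _).1 hex z hz
  have hz : (coinvComplex P).iCycles n z = ((coinvComplex P).d (n + 1) n).hom w := by
    rw [← hw]
    exact congr($((coinvComplex P).toCycles_i (n + 1) n) w)
  refine (QuotientAddGroup.eq_zero_iff _).2 ⟨P.complex.X (n + 1), P.projective _,
    pointHom (coinvNorm _ w) (coinvNorm_invariant _ _), (augmented P).toCycles (n + 2) (n + 1), ?_⟩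
  rw [← cancel_mono ((augmented P).iCycles (n + 1)), HomologicalComplex.liftCycles_i]
  refine (Category.assoc _ _ _).trans ((congrArg (CategoryStruct.comp _)
    ((augmented P).toCycles_i (n + 2) (n + 1))).trans ?_)
  refine pointHom_comp_eq _ _ _ ((coinvNorm_naturality (P.complex.d (n + 1) n) w).trans ?_)
  rw [hz]
  rfl

/-- The isomorphism `Hₙ(G, k) ⟶ Ĥ⁻ⁿ⁻¹(G, k)` for `n > 0`, computed with the resolution `P`. -/
def homologyToTate {n : ℕ} (hn : 0 < n) :
    groupHomology (Rep.trivial k G k) n →+ TateNeg P (n + 1) :=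
  letI := Classical.decEq G
  (((coinvComplex P).homologyπ n).hom.toAddMonoidHom.liftOfSurjective
    (homologyπ_surjective P n) ⟨cyclesToTate P hn, cyclesToTate_ker P hn⟩).comp
    (groupHomologyIso (Rep.trivial k G k) n P).hom.hom.toAddMonoidHom

end Group


/-! ### Singular chains -/

section Singular

open Finsupp

/-- Singular chains of degree `n`: the free abelian group on the continuous maps `Δⁿ ⟶ X`. -/
abbrev SingChain (X : Type u) [TopologicalSpace X] (n : ℕ) : Type u :=
  C(stdSimplex ℝ (Fin (n + 1)), X) →₀ ℤ

variable {X : Type u} [TopologicalSpace X]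

/-- The inclusion `Δⁿ ⟶ Δⁿ⁺¹` of the face opposite to the `i`-th vertex. -/
def faceInclusion {n : ℕ} (i : Fin (n + 2)) :
    C(stdSimplex ℝ (Fin (n + 1)), stdSimplex ℝ (Fin (n + 2))) :=
  ⟨stdSimplex.map i.succAbove, stdSimplex.continuous_map _⟩

/-- The singular boundary `∂ σ = ∑ i, (-1)ⁱ • (σ restricted to the i-th face)`. -/
def boundary (n : ℕ) : SingChain X (n + 1) →ₗ[ℤ] SingChain X n :=
  linearCombination ℤ fun σ =>
    ∑ i : Fin (n + 2), (-1 : ℤ) ^ (i : ℕ) • single (σ.comp (faceInclusion i)) (1 : ℤ)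

/-- The augmentation `C₀(X) ⟶ ℤ`. -/
def singAug : SingChain X 0 →ₗ[ℤ] ℤ := linearCombination ℤ fun _ => 1

/-- The cycles of the augmented singular complex; in positive degrees these are the singular
cycles. -/
def singCycles (X : Type u) [TopologicalSpace X] : (n : ℕ) → Submodule ℤ (SingChain X n)
  | 0 => LinearMap.ker singAug
  | n + 1 => LinearMap.ker (boundary n)

variable {G : Type} [Group G] [MulAction G X] [ContinuousConstSMul G X]

/-- The action of `g` on singular chains, `σ ↦ g ∘ σ`. -/
def chainAct (g : G) (n : ℕ) : SingChain X n →ₗ[ℤ] SingChain X n :=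
  lmapDomain ℤ ℤ fun σ => (⟨fun x => g • x, continuous_const_smul g⟩ : C(X, X)).comp σ

/-- The `G`-invariant singular chains. -/
def invChains (G : Type) [Group G] (X : Type u) [TopologicalSpace X] [MulAction G X]
    [ContinuousConstSMul G X] (n : ℕ) : Submodule ℤ (SingChain X n) :=
  ⨅ g : G, LinearMap.eqLocus (chainAct g n) LinearMap.id

/-- The `G`-invariant singular cycles. -/
def invCycles (G : Type) [Group G] (X : Type u) [TopologicalSpace X] [MulAction G X]
    [ContinuousConstSMul G X] (n : ℕ) : Submodule ℤ (SingChain X n) :=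
  invChains G X n ⊓ singCycles X n

lemma chainAct_of_mem {n : ℕ} {x : SingChain X n} (hx : x ∈ invChains G X n) (g : G) :
    chainAct g n x = x :=
  LinearMap.mem_eqLocus.1 ((Submodule.mem_iInf _).1 hx g)

end Singular

/-! ### Joins of spaces and of singular chains -/

section Join

open Topology

variable (A B : Type u) [TopologicalSpace A] [TopologicalSpace B]

/-- The relation `(a, b, 0) ∼ (a, b', 0)`, `(a, b, 1) ∼ (a', b, 1)` on `A × B × [0, 1]`. -/
def joinSetoid : Setoid (A × B × unitInterval) where
  r p q := p.2.2 = q.2.2 ∧ (p.2.2 ≠ 1 → p.1 = q.1) ∧ (p.2.2 ≠ 0 → p.2.1 = q.2.1)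
  iseqv :=
    { refl := fun _ => ⟨rfl, fun _ => rfl, fun _ => rfl⟩
      symm := fun ⟨h, h₁, h₂⟩ =>
        ⟨h.symm, fun ht => (h₁ (h ▸ ht)).symm, fun ht => (h₂ (h ▸ ht)).symm⟩
      trans := fun ⟨h, h₁, h₂⟩ ⟨h', h₁', h₂'⟩ =>
        ⟨h.trans h', fun ht => (h₁ ht).trans (h₁' (h ▸ ht)),
          fun ht => (h₂ ht).trans (h₂' (h ▸ ht))⟩ }

/-- The join `A * B` of two (non-empty) spaces, with the quotient topology. -/
def TopJoin : Type u := Quotient (joinSetoid A B)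

instance : TopologicalSpace (TopJoin A B) :=
  inferInstanceAs (TopologicalSpace (Quotient (joinSetoid A B)))

variable {A B}

/-- The quotient map `A × B × [0, 1] ⟶ A * B`. -/
def TopJoin.proj : C(A × B × unitInterval, TopJoin A B) :=
  ⟨Quotient.mk (joinSetoid A B), continuous_quotient_mk'⟩

section Action

variable {G : Type} [Group G] [MulAction G A] [MulAction G B]

/-- The diagonal action `g (a, b, t) = (g a, g b, t)`. -/
instance : MulAction G (TopJoin A B) where
  smul g := Quotient.map (fun p => (g • p.1, g • p.2.1, p.2.2)) (fun _ _ ⟨h, h₁, h₂⟩ =>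
    ⟨h, fun ht => congrArg (g • ·) (h₁ ht), fun ht => congrArg (g • ·) (h₂ ht)⟩)
  one_smul := by
    rintro ⟨a, b, t⟩
    exact congrArg (Quotient.mk (joinSetoid A B)) (by simp)
  mul_smul g g' := by
    rintro ⟨a, b, t⟩
    exact congrArg (Quotient.mk (joinSetoid A B)) (by simp [mul_smul])

lemma TopJoin.smul_proj (g : G) (a : A) (b : B) (t : unitInterval) :
    g • TopJoin.proj (a, b, t) = TopJoin.proj (g • a, g • b, t) := rfl

instance [ContinuousConstSMul G A] [ContinuousConstSMul G B] :
    ContinuousConstSMul G (TopJoin A B) where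
  continuous_const_smul g := by
    refine (isQuotientMap_quotient_mk' (s := joinSetoid A B)).continuous_iff.2 ?_
    have h : Continuous fun p : A × B × unitInterval => (g • p.1, g • p.2.1, p.2.2) := by fun_prop
    exact TopJoin.proj.continuous.comp h

end Action

/-- The coordinates of the point `(1 - t) x + t y` of `Δⁿ⁺ᵐ⁺¹ = Δⁿ * Δᵐ`. -/
def joinCoordFun {n m : ℕ} (x : Fin (n + 1) → ℝ) (y : Fin (m + 1) → ℝ) (t : ℝ) :
    Fin (n + m + 1 + 1) → ℝ := fun i =>
  Fin.append (fun j => (1 - t) * x j) (fun j => t * y j)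
    (Fin.cast (by omega : n + m + 1 + 1 = (n + 1) + (m + 1)) i)

lemma joinCoordFun_left {n m : ℕ} (x : Fin (n + 1) → ℝ) (y : Fin (m + 1) → ℝ) (t : ℝ)
    (j : Fin (n + 1)) :
    joinCoordFun x y t (finCongr (by omega) (Fin.castAdd (m + 1) j)) = (1 - t) * x j :=
  Fin.append_left (fun j => (1 - t) * x j) (fun j => t * y j) j

lemma joinCoordFun_right {n m : ℕ} (x : Fin (n + 1) → ℝ) (y : Fin (m + 1) → ℝ) (t : ℝ)
    (j : Fin (m + 1)) :
    joinCoordFun x y t (finCongr (by omega) (Fin.natAdd (n + 1) j)) = t * y j :=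
  Fin.append_right (fun j => (1 - t) * x j) (fun j => t * y j) j

lemma sum_joinIndex {n m : ℕ} (f : Fin (n + m + 1 + 1) → ℝ) :
    ∑ i, f i = ∑ j : Fin (n + 1), f (finCongr (by omega) (Fin.castAdd (m + 1) j)) +
      ∑ j : Fin (m + 1), f (finCongr (by omega) (Fin.natAdd (n + 1) j)) := by
  rw [← (finCongr (by omega : (n + 1) + (m + 1) = n + m + 1 + 1)).sum_comp, Fin.sum_univ_add]

lemma joinCoordFun_mem {n m : ℕ} (x : stdSimplex ℝ (Fin (n + 1))) (y : stdSimplex ℝ (Fin (m + 1)))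
    (t : unitInterval) :
    joinCoordFun (x : Fin (n + 1) → ℝ) y t ∈ stdSimplex ℝ (Fin (n + m + 1 + 1)) := by
  refine ⟨fun i => ?_, ?_⟩
  · obtain ⟨i, rfl⟩ := (finCongr (by omega : (n + 1) + (m + 1) = n + m + 1 + 1)).surjective i
    refine Fin.addCases (fun j => ?_) (fun j => ?_) i
    · rw [joinCoordFun_left]
      exact mul_nonneg (sub_nonneg.2 t.2.2) (x.2.1 j)
    · rw [joinCoordFun_right]
      exact mul_nonneg t.2.1 (y.2.1 j)
  · rw [sum_joinIndex]
    simp only [joinCoordFun_left, joinCoordFun_right, ← Finset.mul_sum]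
    rw [show ∑ j, (x : Fin (n + 1) → ℝ) j = 1 from x.2.2,
      show ∑ j, (y : Fin (m + 1) → ℝ) j = 1 from y.2.2]
    ring

/-- The map `Δⁿ × Δᵐ × [0, 1] ⟶ Δⁿ⁺ᵐ⁺¹`, `(x, y, t) ↦ ((1 - t) x, t y)`, which exhibits `Δⁿ⁺ᵐ⁺¹`
as the join of its front face `Δⁿ` and its back face `Δᵐ`. -/
def joinCoord (n m : ℕ) :
    C(stdSimplex ℝ (Fin (n + 1)) × stdSimplex ℝ (Fin (m + 1)) × unitInterval,
      stdSimplex ℝ (Fin (n + m + 1 + 1))) where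
  toFun p := ⟨joinCoordFun p.1 p.2.1 p.2.2,
    joinCoordFun_mem _ _ _⟩
  continuous_toFun := by
    refine Continuous.subtype_mk (continuous_pi fun i => ?_) _
    obtain ⟨i, rfl⟩ := (finCongr (by omega : (n + 1) + (m + 1) = n + m + 1 + 1)).surjective i
    refine Fin.addCases (fun j => ?_) (fun j => ?_) i
    · simp only [joinCoordFun_left]
      have h : Continuous fun p : stdSimplex ℝ (Fin (n + 1)) × stdSimplex ℝ (Fin (m + 1)) ×
          unitInterval => p.1.1 j := (continuous_apply j).comp (by fun_prop)
      have h' : Continuous fun p : stdSimplex ℝ (Fin (n + 1)) × stdSimplex ℝ (Fin (m + 1)) ×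
          unitInterval => (p.2.2 : ℝ) := by fun_prop
      exact (continuous_const.sub h').mul h
    · simp only [joinCoordFun_right]
      have h : Continuous fun p : stdSimplex ℝ (Fin (n + 1)) × stdSimplex ℝ (Fin (m + 1)) ×
          unitInterval => p.2.1.1 j := (continuous_apply j).comp (by fun_prop)
      have h' : Continuous fun p : stdSimplex ℝ (Fin (n + 1)) × stdSimplex ℝ (Fin (m + 1)) ×
          unitInterval => (p.2.2 : ℝ) := by fun_prop
      exact h'.mul h

lemma exists_normalize {ι : Type} [Fintype ι] [Nonempty ι] (z : ι → ℝ) (hz : ∀ i, 0 ≤ z i) :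
    ∃ x : stdSimplex ℝ ι, ∀ i, (∑ j, z j) * x.1 i = z i := by
  classical
  by_cases h : ∑ j, z j = 0
  · have h0 := (Finset.sum_eq_zero_iff_of_nonneg fun i _ => hz i).1 h
    exact ⟨stdSimplex.vertex (Classical.arbitrary ι), fun i => by
      rw [h, zero_mul, h0 i (Finset.mem_univ i)]⟩
  · refine ⟨⟨fun i => z i / ∑ j, z j, fun i =>
      div_nonneg (hz i) (Finset.sum_nonneg fun j _ => hz j), ?_⟩, fun i => mul_div_cancel₀ _ h⟩
    rw [← Finset.sum_div, div_self h]

lemma joinCoord_surjective (n m : ℕ) : Function.Surjective (joinCoord n m) := by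
  intro z
  obtain ⟨x, hx⟩ := exists_normalize
    (fun j : Fin (n + 1) => z.1 (finCongr (by omega) (Fin.castAdd (m + 1) j))) fun j => z.2.1 _
  obtain ⟨y, hy⟩ := exists_normalize
    (fun j : Fin (m + 1) => z.1 (finCongr (by omega) (Fin.natAdd (n + 1) j))) fun j => z.2.1 _
  have hsum := (sum_joinIndex z.1).symm.trans z.2.2
  have h0 : 0 ≤ ∑ j : Fin (n + 1), z.1 (finCongr (by omega) (Fin.castAdd (m + 1) j)) :=
    Finset.sum_nonneg fun j _ => z.2.1 _
  have h1 : 0 ≤ ∑ j : Fin (m + 1), z.1 (finCongr (by omega) (Fin.natAdd (n + 1) j)) :=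
    Finset.sum_nonneg fun j _ => z.2.1 _
  refine ⟨(x, y, ⟨∑ j : Fin (m + 1), z.1 (finCongr (by omega) (Fin.natAdd (n + 1) j)), h1,
    by linarith⟩), Subtype.ext (funext fun i => ?_)⟩
  obtain ⟨i, rfl⟩ := (finCongr (by omega : (n + 1) + (m + 1) = n + m + 1 + 1)).surjective i
  refine Fin.addCases (fun j => ?_) (fun j => ?_) i
  · refine (joinCoordFun_left _ _ _ j).trans ?_
    exact (congrArg (· * x.1 j) (eq_sub_of_add_eq hsum).symm).trans (hx j)
  · exact (joinCoordFun_right _ _ _ j).trans (hy j)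

lemma joinCoord_isQuotientMap (n m : ℕ) : IsQuotientMap (joinCoord n m) :=
  (joinCoord n m).continuous.isClosedMap.isQuotientMap (joinCoord n m).continuous
    (joinCoord_surjective n m)

lemma joinCoord_factors {n m : ℕ} (σ : C(stdSimplex ℝ (Fin (n + 1)), A))
    (τ : C(stdSimplex ℝ (Fin (m + 1)), B)) :
    Function.FactorsThrough
      (TopJoin.proj.comp (σ.prodMap (τ.prodMap (ContinuousMap.id unitInterval))))
      (joinCoord n m) := by
  rintro ⟨x, y, t⟩ ⟨x', y', t'⟩ h
  have hf : joinCoordFun (x : Fin (n + 1) → ℝ) y t = joinCoordFun (x' : Fin (n + 1) → ℝ) y' t' :=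
    congrArg Subtype.val h
  have hl : ∀ j, (1 - (t : ℝ)) * x.1 j = (1 - (t' : ℝ)) * x'.1 j := fun j =>
    (joinCoordFun_left _ _ _ j).symm.trans ((congrFun hf _).trans (joinCoordFun_left _ _ _ j))
  have hr : ∀ j, (t : ℝ) * y.1 j = (t' : ℝ) * y'.1 j := fun j =>
    (joinCoordFun_right _ _ _ j).symm.trans ((congrFun hf _).trans (joinCoordFun_right _ _ _ j))
  have ht : (t : ℝ) = t' := by
    have := Finset.sum_congr (rfl : Finset.univ = Finset.univ) fun j _ => hr j
    rwa [← Finset.mul_sum, ← Finset.mul_sum, y.2.2, y'.2.2, mul_one, mul_one] at this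
  obtain rfl : t = t' := Subtype.ext ht
  refine Quotient.sound (s := joinSetoid A B) ⟨rfl, fun h1 => congrArg σ ?_, fun h0 => congrArg τ ?_⟩
  · have h1' : 1 - (t : ℝ) ≠ 0 := fun h => h1 (Subtype.ext (sub_eq_zero.1 h).symm)
    exact Subtype.ext (funext fun j => mul_left_cancel₀ h1' (hl j))
  · have h0' : (t : ℝ) ≠ 0 := fun h => h0 (Subtype.ext h)
    exact Subtype.ext (funext fun j => mul_left_cancel₀ h0' (hr j))

/-- The join `σ * τ : Δⁿ⁺ᵐ⁺¹ ⟶ A * B` of singular simplices, the unique map with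
`(σ * τ) ((1 - t) x, t y) = (σ x, τ y, t)`. -/
def joinSimplex {n m : ℕ} (σ : C(stdSimplex ℝ (Fin (n + 1)), A))
    (τ : C(stdSimplex ℝ (Fin (m + 1)), B)) : C(stdSimplex ℝ (Fin (n + m + 1 + 1)), TopJoin A B) :=
  (joinCoord_isQuotientMap n m).lift
    (TopJoin.proj.comp (σ.prodMap (τ.prodMap (ContinuousMap.id unitInterval))))
    (joinCoord_factors σ τ)

lemma joinSimplex_apply {n m : ℕ} (σ : C(stdSimplex ℝ (Fin (n + 1)), A))
    (τ : C(stdSimplex ℝ (Fin (m + 1)), B)) (x : stdSimplex ℝ (Fin (n + 1)))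
    (y : stdSimplex ℝ (Fin (m + 1))) (t : unitInterval) :
    joinSimplex σ τ (joinCoord n m (x, y, t)) = TopJoin.proj (σ x, τ y, t) :=
  congr($((joinCoord_isQuotientMap n m).lift_comp _ (joinCoord_factors σ τ)) (x, y, t))

/-- The join `s * t` of singular chains, the bilinear extension of the join of simplices. -/
def joinChain (n m : ℕ) :
    SingChain A n →ₗ[ℤ] SingChain B m →ₗ[ℤ] SingChain (TopJoin A B) (n + m + 1) :=
  Finsupp.linearCombination ℤ fun σ => Finsupp.linearCombination ℤ fun τ =>
    Finsupp.single (joinSimplex σ τ) (1 : ℤ)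

end Join

/-! ### The class of an invariant singular cycle -/

section Represents

variable {G : Type} [Group G] (X : Type u) [TopologicalSpace X] [MulAction G X]
  [ContinuousConstSMul G X]

/-- A `ℤ[G]`-linear chain map `C_*(X) ⟶ P` over the identity of `ℤ`, from the augmented singular
complex of a `G`-space to a projective resolution of `ℤ`. -/
structure Comparison (P : ProjectiveResolution (Rep.trivial ℤ G ℤ)) where
  /-- The components of the chain map. -/
  f (n : ℕ) : SingChain X n →+ P.complex.X n
  act (n : ℕ) (g : G) (x : SingChain X n) :
    f n (chainAct g n x) = (P.complex.X n).ρ g (f n x)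
  comm (n : ℕ) (x : SingChain X (n + 1)) :
    (P.complex.d (n + 1) n).hom (f (n + 1) x) = f n (boundary n x)
  aug (x : SingChain X 0) : (augmentation P).hom (f 0 x) = singAug x

variable {X} {P : ProjectiveResolution (Rep.trivial ℤ G ℤ)}

lemma Comparison.d_cycle (φ : Comparison X P) : {n : ℕ} → (z : invCycles G X n) →
    ((augmented P).d (n + 1) n).hom (φ.f n z) = 0
  | 0, z => (φ.aug z).trans z.2.2
  | n + 1, z => (φ.comm n z).trans ((congrArg (φ.f n) z.2.2).trans (map_zero _))

/-- The class in `Ĥ⁻ⁿ⁻¹(G, ℤ)` of an invariant singular cycle. -/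
def Comparison.tateClass (φ : Comparison X P) {n : ℕ} (z : invCycles G X n) : TateNeg P (n + 1) :=
  cycleClass P (φ.f n z) (fun g => by rw [← φ.act, chainAct_of_mem z.2.1]) (φ.d_cycle z)

variable [Fintype G]

/-- The invariant singular cycle `z` represents the class `c ∈ Hₙ(G, ℤ)`: for every projective
resolution `P` of `ℤ`, comparison maps `C_*(X) ⟶ P` exist, and each of them sends `z` to an
invariant cycle whose class in `Ĥ⁻ⁿ⁻¹(G, ℤ)` corresponds to `c`. -/
def Represents {n : ℕ} (hn : 0 < n) (z : invCycles G X n)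
    (c : groupHomology (Rep.trivial ℤ G ℤ) n) : Prop :=
  ∀ P : ProjectiveResolution (Rep.trivial ℤ G ℤ),
    Nonempty (Comparison X P) ∧ ∀ φ : Comparison X P, φ.tateClass z = homologyToTate P hn c

end Represents

end TateJoin
end

open CategoryTheory TateJoin

universe w

namespace TateJoin

noncomputable section

universe u₁ u₂ u₃

/-! For finite `G`, a projective module has an identity of the form `∑ g u g⁻¹` with `u` linear.
`NormProjective` records this together with projectivity over the coefficients. It yields
equivariant lifts by averaging, between modules in any universes, so resolutions and singular chains
are treated alike.

On such modules the norm identifies coinvariants with invariants. A map `ℤ → Ωⁿ⁺¹` is an invariant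
cycle of `Pₙ`, and it factors through a projective exactly when that cycle bounds an invariant chain
(`cycleClass_eq_iff`). Hence for `n > 0` both `Hₙ(G, ℤ)` and `Ĥ⁻ⁿ⁻¹` are the homology of `P^G` in
degree `n`. This gives `homologyToTate_bijective`, and the product is the cup product transported
back.

Let `y ∈ Pₘ` be an invariant cycle. The lifts that define `Ψ` form a chain map `Θ` from `P` to
itself of degree `m + 1` with `d Θ₀(c) = ε(c) y`, and `[x] ∪ [y] = [Θ x]`. An equivariant
null-homotopy sends an invariant cycle to an invariant chain. Therefore any chain map with the same
behaviour in degree `0`, out of any augmented complex of projectives, computes the product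
(`cup_cycleClass`). Applied to a morphism of resolutions after `Θ`, this shows independence of `P`.

For the join, take a comparison map `φ` on `EG * EG` and consider `c ↦ φ(c * y)`. Since `∂(c * y) =
∂c * y` in positive degrees, and `∂(c * y)` is `ε(c)` times the second copy of `y` in degree `0`,
this is such a chain map. Its value at `x` is `φ(x * y)` (`cup_tateClass`). The bijection between
classes and invariant cycles modulo invariant boundaries holds because `C_*(EG)` is projective by
freeness and exact by contractibility (`singComplexAug_exact`), hence equivariantly homotopy
equivalent to `P`. -/

lemma exists_dependent_seq {S : ℕ → Type u₁} (R : ∀ n, S n → S (n + 1) → Prop) (s₀ : S 0)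
    (h : ∀ n s, ∃ t, R n s t) : ∃ f : ∀ n, S n, f 0 = s₀ ∧ ∀ n, R n (f n) (f (n + 1)) := by
  choose next hnext using h
  exact ⟨fun n => Nat.rec s₀ (fun n s => next n s) n, rfl, fun n => hnext n _⟩

/-! ### Projective representations of a finite group -/

section NormProjective

variable {k G : Type} [CommRing k] [Group G] [Fintype G]

/-- A `k`-projective representation whose identity is the norm `∑ g, g u g⁻¹` of a linear
endomorphism `u`; for a finite group these are the projective `k[G]`-modules. -/
structure NormProjective {M : Type u₁} [AddCommGroup M] [Module k M]
    (ρ : Representation k G M) : Prop where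
  projective : Module.Projective k M
  exists_norm_eq : ∃ u : M →ₗ[k] M, ∀ x, ∑ g, ρ g (u (ρ g⁻¹ x)) = x

variable {M : Type u₁} [AddCommGroup M] [Module k M] {ρ : Representation k G M}
  {A : Type u₂} [AddCommGroup A] [Module k A] {σ : Representation k G A}
  {B : Type u₃} [AddCommGroup B] [Module k B] {τ : Representation k G B}

/-- Choose a merely linear `l` with `p l = f` and average: for `F = ∑ g l u g⁻¹` one gets `p F = ∑ g
f u g⁻¹ = f (∑ g u g⁻¹) = f`. Surjectivity of `p` is not needed, only that its range contains that
of `f`. -/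
lemma NormProjective.exists_lift (hρ : NormProjective ρ) (p : σ.IntertwiningMap τ)
    (f : ρ.IntertwiningMap τ) (h : ∀ x, ∃ y, p y = f x) :
    ∃ F : ρ.IntertwiningMap σ, ∀ x, p (F x) = f x := by
  obtain ⟨hM, u, hu⟩ := hρ
  obtain ⟨l, hl⟩ := Module.projective_lifting_property p.toLinearMap.rangeRestrict
    (f.toLinearMap.codRestrict (LinearMap.range p.toLinearMap) h)
    p.toLinearMap.surjective_rangeRestrict
  have hl' : ∀ x, p (l x) = f x := fun x => congrArg Subtype.val (LinearMap.congr_fun hl x)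
  let F : M →ₗ[k] A := ∑ g, σ g ∘ₗ l ∘ₗ u ∘ₗ ρ g⁻¹
  have hF : ∀ x, F x = ∑ g, σ g (l (u (ρ g⁻¹ x))) := fun x => by simp [F]
  refine ⟨⟨F, fun h => LinearMap.ext fun x => ?_⟩, fun x => ?_⟩
  · simp only [LinearMap.comp_apply, hF, map_sum]
    refine (Fintype.sum_equiv (Equiv.mulLeft h) _ _ fun g => ?_).symm
    simp [← Module.End.mul_apply, ← map_mul]
  · change p (F x) = f x
    rw [hF, map_sum]
    conv_rhs => rw [← hu x, map_sum]
    refine Finset.sum_congr rfl fun g _ => ?_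
    rw [p.isIntertwining, f.isIntertwining, hl']

lemma NormProjective.of_retract (hσ : NormProjective σ) (s : ρ.IntertwiningMap σ)
    (r : σ.IntertwiningMap ρ) (h : ∀ x, r (s x) = x) : NormProjective ρ := by
  obtain ⟨hA, u, hu⟩ := hσ
  refine ⟨Module.Projective.of_split s.toLinearMap r.toLinearMap (LinearMap.ext h),
    r.toLinearMap ∘ₗ u ∘ₗ s.toLinearMap, fun x => ?_⟩
  refine Eq.trans ?_ ((congrArg r (hu (s x))).trans (h x))
  rw [map_sum]
  refine Finset.sum_congr rfl fun g _ => ?_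
  change ρ g (r (u (s (ρ g⁻¹ x)))) = _
  rw [s.isIntertwining, r.isIntertwining]

/-- A permutation representation on a free `G`-set is projective. -/
lemma NormProjective.of_free {S : Type u₂} [MulAction G S] (hS : ∀ (g : G) (s : S), g • s = s → g = 1)
    {ρ : Representation ℤ G (S →₀ ℤ)}
    (hρ : ∀ g s, ρ g (Finsupp.single s 1) = Finsupp.single (g • s) 1) : NormProjective ρ := by
  classical
  -- The endomorphism `u` is the projection onto the span of a set of orbit representatives.
  let rep : S → S := fun s => Quotient.out (Quotient.mk (MulAction.orbitRel G S) s)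
  have hrep : ∀ s, ∃ g : G, g • rep s = s := fun s =>
    MulAction.orbitRel_apply.1 ((MulAction.orbitRel G S).symm (Quotient.mk_out s))
  have hrep_smul : ∀ (g : G) s, rep (g • s) = rep s := fun g s => by
    refine congrArg Quotient.out (Quotient.sound ?_)
    exact MulAction.orbitRel_apply.2 ⟨g, rfl⟩
  refine ⟨inferInstance, Finsupp.linearCombination ℤ fun s =>
    if rep s = s then Finsupp.single s (1 : ℤ) else 0, fun x => ?_⟩
  induction x using Finsupp.induction_linear with
  | zero => simp
  | add x y hx hy => simpa [Finset.sum_add_distrib] using congrArg₂ (· + ·) hx hy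
  | single s c =>
    obtain ⟨h, hs⟩ := hrep s
    have hc : Finsupp.single s c = c • Finsupp.single s (1 : ℤ) := by simp
    rw [hc]
    simp only [map_smul, ← Finset.smul_sum]
    congr 1
    simp only [hρ, Finsupp.linearCombination_single, one_smul, hrep_smul]
    rw [Finset.sum_eq_single h]
    · rw [if_pos (by rw [eq_inv_smul_iff, hs]), hρ, smul_inv_smul]
    · intro g _ hg
      rw [if_neg, map_zero]
      intro h'
      refine hg ?_
      rw [eq_inv_smul_iff] at h'
      -- Both `g` and `h` carry the representative to `s`, so freeness leaves a single nonzero term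
      -- in the norm.
      have := hS (h⁻¹ * g) (rep s) (by rw [mul_smul, h', inv_smul_eq_iff, hs])
      rw [inv_mul_eq_one] at this
      exact this.symm
    · simp

end NormProjective

/-! ### Complexes of representations -/

/-- A non-negatively graded complex of integral representations. -/
structure RepComplex (G : Type) [Group G] where
  /-- The terms of the complex. -/
  X : ℕ → Type u₁
  [addCommGroup : ∀ n, AddCommGroup (X n)]
  [module : ∀ n, Module ℤ (X n)]
  /-- The action on the terms. -/
  ρ : ∀ n, Representation ℤ G (X n)
  /-- The differential. -/
  d : ∀ n, (ρ (n + 1)).IntertwiningMap (ρ n)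
  d_d : ∀ n x, d n (d (n + 1) x) = 0

namespace RepComplex

attribute [instance] addCommGroup module

variable {G : Type} [Group G]

/-- Equivariant chain maps. -/
structure Hom (C : RepComplex.{u₁} G) (D : RepComplex.{u₂} G) where
  /-- The components of the chain map. -/
  f : ∀ n, (C.ρ n).IntertwiningMap (D.ρ n)
  comm : ∀ n x, D.d n (f (n + 1) x) = f n (C.d n x)

namespace Hom

variable {C : RepComplex.{u₁} G} {D : RepComplex.{u₂} G} {E : RepComplex.{u₃} G}

/-- The difference of two chain maps. -/
def sub (F F' : Hom C D) : Hom C D where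
  f n := F.f n - F'.f n
  comm n x := by simp [F.comm, F'.comm]

lemma sub_apply (F F' : Hom C D) (n : ℕ) (x : C.X n) : (F.sub F').f n x = F.f n x - F'.f n x := rfl

/-- The composition of chain maps. -/
def comp (F' : Hom D E) (F : Hom C D) : Hom C E where
  f n := (F'.f n).comp (F.f n)
  comm n x := by simp [F.comm, F'.comm]

lemma comp_apply (F' : Hom D E) (F : Hom C D) (n : ℕ) (x : C.X n) :
    (F'.comp F).f n x = F'.f n (F.f n x) := rfl

/-- The identity chain map. -/
def id (C : RepComplex.{u₁} G) : Hom C C where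
  f _ := .id _
  comm _ _ := rfl

end Hom

/-- The complex `D` shifted down by `m` degrees and truncated. -/
def shift (D : RepComplex.{u₂} G) (m : ℕ) : RepComplex.{u₂} G where
  X n := D.X (m + n)
  ρ n := D.ρ (m + n)
  d n := D.d (m + n)
  d_d _ := D.d_d _

/-- Exactness in positive degrees. -/
def ExactPos (D : RepComplex.{u₂} G) : Prop :=
  ∀ n x, D.d n x = 0 → ∃ y, D.d (n + 1) y = x

lemma ExactPos.shift {D : RepComplex.{u₂} G} (hD : D.ExactPos) (m : ℕ) : (D.shift m).ExactPos :=
  fun n => hD (m + n)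

variable [Fintype G] {C : RepComplex.{u₁} G} {D : RepComplex.{u₂} G}

/-- The recursion carries along the property that each component sends boundaries to boundaries.
This is what the next lift needs, and exactness of `D` propagates it. -/
lemma exists_hom (hC : ∀ n, NormProjective (C.ρ n)) (hD : D.ExactPos)
    (f₀ : (C.ρ 0).IntertwiningMap (D.ρ 0)) (h₀ : ∀ c, ∃ y, D.d 0 y = f₀ (C.d 0 c)) :
    ∃ F : Hom C D, F.f 0 = f₀ := by
  obtain ⟨F, hF, hF'⟩ := exists_dependent_seq
    (S := fun n => {f : (C.ρ n).IntertwiningMap (D.ρ n) // ∀ c, ∃ y, D.d n y = f (C.d n c)})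
    (fun n f f' => ∀ x, D.d n (f'.1 x) = f.1 (C.d n x)) ⟨f₀, h₀⟩ (fun n f => by
      obtain ⟨f', hf'⟩ := (hC (n + 1)).exists_lift (D.d n) (f.1.comp (C.d n)) f.2
      refine ⟨⟨f', fun c => hD _ _ ?_⟩, hf'⟩
      rw [hf', Representation.IntertwiningMap.comp_apply, C.d_d, map_zero])
  exact ⟨⟨fun n => (F n).1, hF'⟩, congrArg Subtype.val hF⟩

/-- The recursion only has to remember that `d sₙ` and `Fₙ` agree on boundaries: then `Fₙ₊₁ - sₙ d`
takes values in cycles, hence in boundaries, and lifts. The degree-zero hypothesis gives `d s₀ =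
F₀`. -/
lemma exists_homotopy (hC : ∀ n, NormProjective (C.ρ n)) (hD : D.ExactPos) (F : Hom C D)
    (h₀ : ∀ c, ∃ y, D.d 0 y = F.f 0 c) :
    ∃ s : ∀ n, (C.ρ n).IntertwiningMap (D.ρ (n + 1)),
      ∀ n x, D.d (n + 1) (s (n + 1) x) = F.f (n + 1) x - s n (C.d n x) := by
  obtain ⟨s₀, hs₀⟩ := (hC 0).exists_lift (D.d 0) (F.f 0) h₀
  obtain ⟨s, -, hs⟩ := exists_dependent_seq
    (S := fun n => {s : (C.ρ n).IntertwiningMap (D.ρ (n + 1)) //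
      ∀ c, D.d n (s (C.d n c)) = F.f n (C.d n c)})
    (fun n s s' => ∀ x, D.d (n + 1) (s'.1 x) = F.f (n + 1) x - s.1 (C.d n x))
    ⟨s₀, fun c => hs₀ _⟩ (fun n s => by
      obtain ⟨s', hs'⟩ := (hC (n + 1)).exists_lift (D.d (n + 1)) (F.f (n + 1) - s.1.comp (C.d n))
        (fun x => hD _ _ (by simp [F.comm, s.2]))
      refine ⟨⟨s', fun c => ?_⟩, hs'⟩
      rw [hs']
      simp [C.d_d])
  exact ⟨fun n => (s n).1, hs⟩

/-- A chain map which vanishes on homology in degree `0` sends invariant cycles of positive degree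
to boundaries of invariant chains. -/
lemma exists_invariant_boundary (hC : ∀ n, NormProjective (C.ρ n)) (hD : D.ExactPos) (F : Hom C D)
    (h₀ : ∀ c, ∃ y, D.d 0 y = F.f 0 c) {n : ℕ} {z : C.X (n + 1)} (hz : ∀ g, C.ρ (n + 1) g z = z)
    (hd : C.d n z = 0) : ∃ w, (∀ g, D.ρ (n + 2) g w = w) ∧ D.d (n + 1) w = F.f (n + 1) z := by
  obtain ⟨s, hs⟩ := exists_homotopy hC hD F h₀
  exact ⟨s (n + 1) z, fun g => by rw [← (s (n + 1)).isIntertwining, hz],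
    by rw [hs, hd, map_zero, sub_zero]⟩

/-- An augmentation of a complex to the trivial module `ℤ`. -/
structure Aug (C : RepComplex.{u₁} G) where
  /-- The augmentation. -/
  ε : (C.ρ 0).IntertwiningMap (Representation.trivial ℤ G ℤ)
  ε_d : ∀ x, ε (C.d 0 x) = 0

/-- The augmented complex is exact. -/
structure Aug.Exact {D : RepComplex.{u₂} G} (e : D.Aug) : Prop where
  surjective : Function.Surjective e.ε
  exact_zero : ∀ x, e.ε x = 0 → ∃ y, D.d 0 y = x
  exactPos : D.ExactPos

lemma exists_augHom (hC : ∀ n, NormProjective (C.ρ n)) (e : C.Aug) {e' : D.Aug} (he' : e'.Exact) :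
    ∃ F : Hom C D, ∀ x, e'.ε (F.f 0 x) = e.ε x := by
  obtain ⟨f₀, hf₀⟩ := (hC 0).exists_lift e'.ε e.ε fun x => he'.surjective _
  obtain ⟨F, hF⟩ := exists_hom hC he'.exactPos f₀
    (fun c => he'.exact_zero _ (by rw [hf₀, e.ε_d]))
  exact ⟨F, fun x => by rw [hF, hf₀]⟩

/-- In degree zero the difference of the two maps lands in the kernel of the augmentation, that is,
in the boundaries. -/
lemma exists_invariant_boundary_sub (hC : ∀ n, NormProjective (C.ρ n)) (e : C.Aug) {e' : D.Aug}
    (he' : e'.Exact) {F F' : Hom C D} (hF : ∀ x, e'.ε (F.f 0 x) = e.ε x)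
    (hF' : ∀ x, e'.ε (F'.f 0 x) = e.ε x) {n : ℕ} {z : C.X (n + 1)}
    (hz : ∀ g, C.ρ (n + 1) g z = z) (hd : C.d n z = 0) :
    ∃ w, (∀ g, D.ρ (n + 2) g w = w) ∧ D.d (n + 1) w = F.f (n + 1) z - F'.f (n + 1) z :=
  exists_invariant_boundary hC he'.exactPos (F.sub F')
    (fun c => he'.exact_zero _ (by rw [Hom.sub_apply, map_sub, hF, hF', sub_self])) hz hd

end RepComplex

/-! ### Projective resolutions as complexes of representations -/

section Resolution

variable {G : Type} [Group G]

lemma rep_exists_of_exact {k G : Type} [CommRing k] [Group G] {S : ShortComplex (Rep.{0} k G)}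
    (hS : S.Exact) (x : S.X₂) (hx : S.g.hom x = 0) : ∃ y, S.f.hom y = x := by
  have h := hS.map (forget₂ (Rep.{0} k G) (ModuleCat.{0} k))
  exact (ShortComplex.moduleCat_exact_iff _).1 h x hx

lemma NormProjective.free {k G : Type} [CommRing k] [Group G] [Fintype G] (α : Type) :
    NormProjective (Representation.free k G α) := by
  classical
  -- On each copy of `k[G]` the endomorphism `u` keeps the coefficient of the unit element and kills
  -- the others.
  let v : MonoidAlgebra k G →ₗ[k] MonoidAlgebra k G :=
    MonoidAlgebra.lsingle 1 ∘ₗ Finsupp.lapply 1 ∘ₗ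
      (MonoidAlgebra.coeffLinearEquiv (S := k) (M := G) k).toLinearMap
  have hv : ∀ (g : G) (r : k), v (.single g r) = if g = 1 then .single 1 r else 0 := fun g r => by
    simp [v, Finsupp.single_apply]
    split_ifs <;> simp
  refine ⟨inferInstance, Finsupp.mapRange.linearMap v, fun x => ?_⟩
  induction x using Finsupp.induction_linear with
  | zero => simp
  | add x y hx hy => simp only [map_add, Finset.sum_add_distrib, hx, hy]
  | single a x =>
    induction x using MonoidAlgebra.induction_linear with
    | zero => simp
    | add x y hx hy => simp only [Finsupp.single_add, map_add, Finset.sum_add_distrib, hx, hy]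
    | single h r =>
      rw [Finset.sum_eq_single h]
      · simp [hv]
      · intro g _ hg
        have : g⁻¹ * h ≠ 1 := fun h' => hg (inv_mul_eq_one.1 h')
        simp [hv, this]
      · simp

/-- The module is a retract of the free module on its underlying set. -/
lemma normProjective_of_projective {k G : Type} [CommRing k] [Group G] [Fintype G]
    (A : Rep.{0} k G) [Projective A] : NormProjective A.ρ := by
  classical
  let π : Rep.free k G A ⟶ A := Rep.freeLift k G A (fun a => a)
  have hπ : Epi π := (Rep.epi_iff_surjective _).2 fun a =>
    ⟨Finsupp.single a (.single 1 1), by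
      simp [π, Rep.freeLift]⟩
  have hF : NormProjective (Rep.free k G A).ρ := by
    exact NormProjective.free A
  refine hF.of_retract (Projective.factorThru (𝟙 A) π).hom π.hom fun x => ?_
  exact congr($(Projective.factorThru_comp (𝟙 A) π).hom x)

variable (P : ProjectiveResolution (Rep.trivial ℤ G ℤ))

/-- The complex of representations underlying a projective resolution. -/
def resComplex : RepComplex.{0} G where
  X n := P.complex.X n
  addCommGroup n := (P.complex.X n).hV1
  module n := (P.complex.X n).hV2
  ρ n := (P.complex.X n).ρ
  d n := (P.complex.d (n + 1) n).hom
  d_d n x := congr($(P.complex.d_comp_d (n + 2) (n + 1) n).hom x)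

/-- The augmentation of a projective resolution of `ℤ`. -/
def resAug : (resComplex P).Aug where
  ε := (augmentation P).hom
  ε_d x := congr($(P.complex_d_comp_π_f_zero).hom x)

lemma resAug_exact : (resAug P).Exact where
  surjective := (Rep.epi_iff_surjective (augmentation P)).1 (inferInstanceAs (Epi (P.π.f 0)))
  exact_zero := rep_exists_of_exact P.exact₀
  exactPos n := rep_exists_of_exact (P.exact_succ n)

lemma resComplex_normProjective [Fintype G] (n : ℕ) : NormProjective ((resComplex P).ρ n) :=
  normProjective_of_projective (P.complex.X n)

end Resolution

/-! ### Classes of invariant cycles in negative Tate cohomology -/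

section CycleClass

variable {k G : Type} [CommRing k] [Group G] (P : ProjectiveResolution (Rep.trivial k G k))

lemma cycleClass_surjective {n : ℕ} (c : TateNeg P (n + 1)) :
    ∃ (x : P.complex.X n) (hx : ∀ g, (P.complex.X n).ρ g x = x)
      (hd : ((augmented P).d (n + 1) n).hom x = 0), cycleClass P x hx hd = c := by
  obtain ⟨f, rfl⟩ := QuotientAddGroup.mk_surjective c
  have hx : ∀ g, (P.complex.X n).ρ g ((f ≫ (augmented P).iCycles (n + 1)).hom (1 : k)) =
      (f ≫ (augmented P).iCycles (n + 1)).hom (1 : k) := fun g =>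
    (Rep.hom_comm_apply (f ≫ (augmented P).iCycles (n + 1)) g (1 : k)).symm
  have hd : ((augmented P).d (n + 1) n).hom
      ((f ≫ (augmented P).iCycles (n + 1)).hom (1 : k)) = 0 := by
    have : (f ≫ (augmented P).iCycles (n + 1)) ≫ (augmented P).d (n + 1) n = 0 := by simp
    exact congr($(this).hom (1 : k))
  refine ⟨_, hx, hd, congrArg StableHom.mk ?_⟩
  rw [← cancel_mono ((augmented P).iCycles (n + 1)), HomologicalComplex.liftCycles_i]
  exact hom_ext_one (one_smul _ _)

/-- If the difference factors through a projective `Q`, lift `Q → Ωⁿ⁺¹` along `Pₙ₊₁ → Ωⁿ⁺¹`; the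
image of `1` in `Pₙ₊₁` is then the invariant chain `q`. Conversely, `q` itself gives a factorization
through `Pₙ₊₁`. -/
lemma cycleClass_eq_iff {n : ℕ} {x x' : P.complex.X n} {hx : ∀ g, (P.complex.X n).ρ g x = x}
    {hd : ((augmented P).d (n + 1) n).hom x = 0} {hx' : ∀ g, (P.complex.X n).ρ g x' = x'}
    {hd' : ((augmented P).d (n + 1) n).hom x' = 0} :
    cycleClass P x hx hd = cycleClass P x' hx' hd' ↔
      ∃ q : P.complex.X (n + 1), (∀ g, (P.complex.X (n + 1)).ρ g q = q) ∧
        (P.complex.d (n + 1) n).hom q = x - x' := by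
  -- Equality in the quotient is tested on `-a + b`; exchanging the sides makes this `x - x'`.
  rw [eq_comm]
  refine (QuotientAddGroup.eq (s := PHom _ _)).trans ⟨?_, ?_⟩
  · rintro ⟨Q, hQ, a, b, hab⟩
    have : Epi ((augmented P).toCycles (n + 2) (n + 1)) := (syzygySeq_shortExact P (n + 1)).epi_g
    let b' : Q ⟶ (augmented P).X (n + 2) := Projective.factorThru b ((augmented P).toCycles (n + 2) (n + 1))
    have hb' : b' ≫ (augmented P).toCycles (n + 2) (n + 1) = b := Projective.factorThru_comp _ _
    refine ⟨(a ≫ b').hom (1 : k), fun g => (Rep.hom_comm_apply (a ≫ b') g (1 : k)).symm, ?_⟩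
    have key : (a ≫ b') ≫ (augmented P).d (n + 2) (n + 1) =
        -pointHom (A := (augmented P).X (n + 1)) x' hx' +
          pointHom (A := (augmented P).X (n + 1)) x hx := by
      rw [← HomologicalComplex.toCycles_i, Category.assoc, reassoc_of% hb', reassoc_of% hab]
      simp
    refine (congr($(key).hom (1 : k))).trans ?_
    change -((1 : k) • x') + (1 : k) • x = _
    rw [one_smul, one_smul, neg_add_eq_sub]
  · rintro ⟨q, hq, hdq⟩
    refine ⟨P.complex.X (n + 1), P.projective _, pointHom q hq,
      (augmented P).toCycles (n + 2) (n + 1), ?_⟩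
    rw [← cancel_mono ((augmented P).iCycles (n + 1)), Preadditive.add_comp, Preadditive.neg_comp,
      HomologicalComplex.liftCycles_i, HomologicalComplex.liftCycles_i]
    refine (Category.assoc _ _ _).trans ((congrArg (CategoryStruct.comp _)
      ((augmented P).toCycles_i (n + 2) (n + 1))).trans ?_)
    refine hom_ext_one ?_
    change (P.complex.d (n + 1) n).hom ((1 : k) • q) = -((1 : k) • x') + (1 : k) • x
    rw [one_smul, one_smul, one_smul, hdq, neg_add_eq_sub]

end CycleClass

/-! ### The comparison of group homology with negative Tate cohomology -/

section Norm

variable {k G : Type} [CommRing k] [Group G] [Fintype G]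

/-- The preimage is the class of `u x`: for invariant `x`, `∑ g u x = ∑ g u g⁻¹ x = x`. -/
lemma exists_coinvNorm_eq {A : Rep k G} (hA : NormProjective A.ρ) (x : A)
    (hx : ∀ g, A.ρ g x = x) : ∃ z, coinvNorm A z = x := by
  obtain ⟨-, u, hu⟩ := hA
  refine ⟨Rep.coinvariantsTensorMk (Rep.trivial k G k) A 1 (u x), ?_⟩
  rw [coinvNorm_mk, one_smul]
  conv_rhs => rw [← hu x]
  simp [Representation.norm, hx]

/-- A left inverse is `z ↦ ⟦1 ⊗ u (N z)⟧`: modulo the action, `u (∑ g y)` equals `∑ g u g⁻¹ y = y`.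
-/
lemma coinvNorm_injective {A : Rep k G} (hA : NormProjective A.ρ) :
    Function.Injective (coinvNorm A) := by
  obtain ⟨-, u, hu⟩ := hA
  have hmk : ∀ (g : G) (y : A), Rep.coinvariantsTensorMk (Rep.trivial k G k) A 1 (A.ρ g y) =
      Rep.coinvariantsTensorMk (Rep.trivial k G k) A 1 y := fun g y =>
    Representation.Coinvariants.mk_self_apply ((Rep.trivial k G k).ρ.tprod A.ρ) g
      (TensorProduct.tmul k (1 : k) y)
  have hinv : ∀ z, Rep.coinvariantsTensorMk (Rep.trivial k G k) A 1 (u (coinvNorm A z)) = z := by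
    intro z
    obtain ⟨t, rfl⟩ := Representation.Coinvariants.mk_surjective _ z
    induction t using TensorProduct.induction_on with
    | zero => simp
    | tmul c y =>
      change Rep.coinvariantsTensorMk (Rep.trivial k G k) A 1 (u (A.ρ.norm (c • y))) =
        Rep.coinvariantsTensorMk (Rep.trivial k G k) A c y
      have h1 : Rep.coinvariantsTensorMk (Rep.trivial k G k) A c y =
          Rep.coinvariantsTensorMk (Rep.trivial k G k) A 1 (c • y) := by
        rw [map_smul, ← LinearMap.smul_apply, ← map_smul, smul_eq_mul, mul_one]
      rw [h1]
      conv_rhs => rw [← hu (c • y)]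
      rw [Representation.norm, LinearMap.sum_apply, map_sum, map_sum, map_sum]
      simp only [hmk]
      exact (Fintype.sum_equiv (Equiv.inv G) _ _ fun g => by simp)
    | add a b ha hb => simp only [map_add, ha, hb]
  intro z z' h
  rw [← hinv z, ← hinv z', h]

variable (P : ProjectiveResolution (Rep.trivial k G k))

lemma cyclesToTate_apply {n : ℕ} (hn : 0 < n) (z : (coinvComplex P).cycles n) :
    cyclesToTate P hn z = cycleClass P
      (coinvNorm (P.complex.X n) ((coinvComplex P).iCycles n z))
      (coinvNorm_invariant _ _) (d_coinvNorm P hn z) := rfl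

/-- An invariant cycle is the norm of some `z`, and `z` is a cycle because the norm is injective one
degree lower. For `n > 0` that lower term is a projective `Pₙ₋₁` and not `ℤ`, where the argument
would fail. -/
lemma cyclesToTate_surjective {n : ℕ} (hn : 0 < n) : Function.Surjective (cyclesToTate P hn) := by
  intro c
  obtain ⟨x, hx, hd, rfl⟩ := cycleClass_surjective P c
  obtain ⟨m, rfl⟩ : ∃ m, n = m + 1 := ⟨n - 1, by omega⟩
  have hP : ∀ n, NormProjective (P.complex.X n).ρ := fun n => normProjective_of_projective _
  obtain ⟨z, rfl⟩ := exists_coinvNorm_eq (hP _) x hx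
  have hz : ((coinvComplex P).d (m + 1) m).hom z = 0 := by
    refine coinvNorm_injective (hP m) ?_
    exact ((coinvNorm_naturality (P.complex.d (m + 1) m) z).symm.trans hd).trans
      (map_zero (coinvNorm (P.complex.X m))).symm
  refine ⟨(coinvComplex P).cyclesMk z m (by simp) hz, ?_⟩
  have hi : (coinvComplex P).iCycles (m + 1) ((coinvComplex P).cyclesMk z m (by simp) hz) = z :=
    (HomologicalComplex.i_cyclesMk (coinvComplex P) z m (by simp) hz :)
  refine (cyclesToTate_apply P hn _).trans ((cycleClass_eq_iff P).2 ⟨0, fun g => map_zero _, ?_⟩)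
  rw [map_zero, hi, sub_self]

/-- If the norm of `z` bounds an invariant `q`, write `q` as the norm of `w`; injectivity of the
norm then gives `z = d w`. -/
lemma cyclesToTate_ker_eq {n : ℕ} (hn : 0 < n) :
    (cyclesToTate P hn).ker ≤ ((coinvComplex P).homologyπ n).hom.toAddMonoidHom.ker := by
  intro z hz
  have hP : ∀ n, NormProjective (P.complex.X n).ρ := fun n => normProjective_of_projective _
  have hz' : cyclesToTate P hn z = cyclesToTate P hn 0 := by
    rw [map_zero]; exact hz
  rw [cyclesToTate_apply, cyclesToTate_apply] at hz'
  obtain ⟨q, hq, hdq⟩ := (cycleClass_eq_iff P).1 hz'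
  obtain ⟨w, rfl⟩ := exists_coinvNorm_eq (hP _) q hq
  have hw : (coinvComplex P).iCycles n z = ((coinvComplex P).d (n + 1) n).hom w := by
    refine coinvNorm_injective (hP n) ?_
    refine Eq.trans ?_ (hdq.symm.trans (coinvNorm_naturality (P.complex.d (n + 1) n) w))
    refine (sub_zero _).symm.trans (congrArg (_ - ·) ?_)
    exact (map_zero (coinvNorm (P.complex.X n))).symm.trans
      (congrArg (coinvNorm (P.complex.X n)) (map_zero _).symm)
  have hw' : (coinvComplex P).toCycles (n + 1) n w = z := by
    refine (ModuleCat.mono_iff_injective ((coinvComplex P).iCycles n)).1 inferInstance ?_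
    rw [hw]
    exact congr($((coinvComplex P).toCycles_i (n + 1) n) w)
  change (coinvComplex P).homologyπ n z = 0
  rw [← hw']
  exact congr($((coinvComplex P).toCycles_comp_homologyπ (n + 1) n) w)

lemma homologyToTate_of_cycle [DecidableEq G] {n : ℕ} (hn : 0 < n)
    (c : groupHomology (Rep.trivial k G k) n) (z : (coinvComplex P).cycles n)
    (hz : (coinvComplex P).homologyπ n z =
      (groupHomologyIso (Rep.trivial k G k) n P).hom c) :
    homologyToTate P hn c = cyclesToTate P hn z := by
  -- `groupHomologyIso` depends on the decidability instance, and the definition of `homologyToTate`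
  -- fixes the classical one.
  obtain rfl : ‹DecidableEq G› = Classical.decEq G := Subsingleton.elim _ _
  refine (congrArg (((coinvComplex P).homologyπ n).hom.toAddMonoidHom.liftOfSurjective
    (homologyπ_surjective P n) ⟨cyclesToTate P hn, cyclesToTate_ker P hn⟩) hz.symm).trans ?_
  exact AddMonoidHom.liftOfRightInverse_comp_apply _ _ _ _ _

omit [Fintype G] in
lemma exists_cycle_homologyToTate [DecidableEq G] {n : ℕ}
    (c : groupHomology (Rep.trivial k G k) n) :
    ∃ z : (coinvComplex P).cycles n, (coinvComplex P).homologyπ n z =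
      (groupHomologyIso (Rep.trivial k G k) n P).hom c :=
  homologyπ_surjective P n _

theorem homologyToTate_bijective {n : ℕ} (hn : 0 < n) :
    Function.Bijective (homologyToTate P hn) := by
  classical
  constructor
  · rw [injective_iff_map_eq_zero]
    intro c hc
    obtain ⟨z, hz⟩ := exists_cycle_homologyToTate P c
    rw [homologyToTate_of_cycle P hn c z hz] at hc
    have := cyclesToTate_ker_eq P hn hc
    have h0 : (groupHomologyIso (Rep.trivial k G k) n P).hom c = 0 := hz.symm.trans this
    refine (ModuleCat.mono_iff_injective (groupHomologyIso (Rep.trivial k G k) n P).hom).1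
      inferInstance ?_
    rw [h0, map_zero]
  · intro t
    obtain ⟨z, rfl⟩ := cyclesToTate_surjective P hn t
    obtain ⟨c, hc⟩ := (ModuleCat.epi_iff_surjective
      (groupHomologyIso (Rep.trivial k G k) n P).hom).1 inferInstance
      ((coinvComplex P).homologyπ n z)
    exact ⟨c, homologyToTate_of_cycle P hn c z hc.symm⟩

/-- A single invariant cycle `x` serves both resolutions, since the identification with group
homology and the norm are both natural in the resolution. -/
lemma homologyToTate_naturality {P P' : ProjectiveResolution (Rep.trivial k G k)}
    (f : P.complex ⟶ P'.complex) (hf : f.f 0 ≫ P'.π.f 0 = P.π.f 0) {n : ℕ} (hn : 0 < n)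
    (c : groupHomology (Rep.trivial k G k) n) :
    ∃ (x : P.complex.X n) (hx : ∀ g, (P.complex.X n).ρ g x = x)
      (hd : ((augmented P).d (n + 1) n).hom x = 0)
      (hx' : ∀ g, (P'.complex.X n).ρ g ((f.f n).hom x) = (f.f n).hom x)
      (hd' : ((augmented P').d (n + 1) n).hom ((f.f n).hom x) = 0),
      homologyToTate P hn c = cycleClass P x hx hd ∧
      homologyToTate P' hn c = cycleClass P' ((f.f n).hom x) hx' hd' := by
  classical
  obtain ⟨z, hz⟩ := exists_cycle_homologyToTate P c
  let F := (Rep.coinvariantsTensor k G).obj (Rep.trivial k G k)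
  let φ : coinvComplex P ⟶ coinvComplex P' := (F.mapHomologicalComplex _).map f
  have hz' : (coinvComplex P').homologyπ n (HomologicalComplex.cyclesMap φ n z) =
      (groupHomologyIso (Rep.trivial k G k) n P').hom c := by
    have h1 := congr($(HomologicalComplex.homologyπ_naturality φ n) z)
    have h2 := P.isoLeftDerivedObj_hom_naturality (𝟙 _) P' f (hf.trans (Category.comp_id _).symm) F n
    rw [CategoryTheory.Functor.map_id, Category.id_comp] at h2
    refine h1.symm.trans ?_
    refine (congrArg (HomologicalComplex.homologyMap φ n) hz).trans ?_
    exact congr($h2.symm ((groupHomologyIsoTor (Rep.trivial k G k) n).hom c))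
  have hi : (coinvComplex P').iCycles n (HomologicalComplex.cyclesMap φ n z) =
      (φ.f n) ((coinvComplex P).iCycles n z) :=
    congr($(HomologicalComplex.cyclesMap_i φ n) z)
  have hn' : (f.f n).hom (coinvNorm (P.complex.X n) ((coinvComplex P).iCycles n z)) =
      coinvNorm (P'.complex.X n)
        ((coinvComplex P').iCycles n (HomologicalComplex.cyclesMap φ n z)) := by
    rw [hi]
    exact coinvNorm_naturality (f.f n) _
  refine ⟨coinvNorm (P.complex.X n) ((coinvComplex P).iCycles n z), coinvNorm_invariant _ _,
    d_coinvNorm P hn z, ?_, ?_, homologyToTate_of_cycle P hn c z hz, ?_⟩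
  · rw [hn']
    exact coinvNorm_invariant _ _
  · rw [hn']
    exact d_coinvNorm P' hn _
  · rw [homologyToTate_of_cycle P' hn c _ hz', cyclesToTate_apply]
    refine (cycleClass_eq_iff P').2 ⟨0, fun g => map_zero _, ?_⟩
    rw [map_zero, hn', sub_self]

end Norm

/-! ### The cup product of classes of invariant cycles -/

section LoopPow

universe u v

variable {C : Type u} [Category.{v} C] [Abelian C] {Z : C} (P : ProjectiveResolution Z)

/-- Exposes the lifts hidden in the iterated `Ψ`: the `K n` represent its values, and the `Θ n` are
the maps of middle terms to be assembled into a chain map. -/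
lemma exists_loopPow_eq {m : ℕ} (g : Z ⟶ Omega P m) :
    ∃ (K : ∀ n, Omega P n ⟶ Omega P (m + n))
      (Θ : ∀ n, (augmented P).X (n + 1) ⟶ (augmented P).X (m + n + 1)),
      K 0 = (augmented P).iCycles 0 ≫ g ∧ (∀ n, loopPow P m n (StableHom.mk g) = StableHom.mk (K n)) ∧
      (∀ n, Θ n ≫ (augmented P).toCycles (m + n + 1) (m + n) =
        (augmented P).toCycles (n + 1) n ≫ K n) ∧
      ∀ n, K (n + 1) ≫ (augmented P).iCycles (m + n + 1) =
        (augmented P).iCycles (n + 1) ≫ Θ n := by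
  let K : ∀ n, Omega P n ⟶ Omega P (m + n) := fun n => Nat.rec ((augmented P).iCycles 0 ≫ g)
    (fun n f => kerMap (S := syzygySeq P n) (T := syzygySeq P (m + n))
      (syzygySeq_shortExact P (m + n)) f) n
  refine ⟨K, fun n => midLift (S := syzygySeq P n) (T := syzygySeq P (m + n))
      (syzygySeq_shortExact P (m + n)) (K n), rfl, fun n => ?_, fun n => midLift_g _ _,
      fun n => kerMap_f (S := syzygySeq P n) _ _⟩
  induction n with
  | zero => rfl
  | succ n ih => exact congrArg (loop (S := syzygySeq P n) (T := syzygySeq P (m + n))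
      (syzygySeq_shortExact P (m + n))) ih

end LoopPow

/-- Transport along an equality of degrees. -/
def RepComplex.castX {G : Type} [Group G] (D : RepComplex.{w} G) {a b : ℕ} (e : a = b) (x : D.X a) :
    D.X b := e ▸ x

section Cup

variable {G : Type} [Group G] (P : ProjectiveResolution (Rep.trivial ℤ G ℤ))

/-- The differential is `toCycles` followed by `iCycles`, so the squares relating `Θ n` and `K n`
paste to a chain map. As `K (n + 1)` is the restriction of `Θ n` to cycles, the composite defining
the cup product sends `1` to `Θ x`. -/
lemma exists_cup_cycleClass {m : ℕ} {y : P.complex.X m} (hy : ∀ g, (P.complex.X m).ρ g y = y)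
    (hdy : ((augmented P).d (m + 1) m).hom y = 0) :
    ∃ Θ : RepComplex.Hom (resComplex P) ((resComplex P).shift (m + 1)),
      (∀ c, (resComplex P).d m (Θ.f 0 c) =
        (pointHom (A := P.complex.X m) y hy).hom ((resAug P).ε c)) ∧
      ∀ {n j : ℕ} {x : P.complex.X n} (hx : ∀ g, (P.complex.X n).ρ g x = x)
        (hdx : ((augmented P).d (n + 1) n).hom x = 0) (h : n + 1 + (m + 1) = j + 1)
        (e : m + 1 + n = j) {w : P.complex.X j} (hw : ∀ g, (P.complex.X j).ρ g w = w)
        (hdw : ((augmented P).d (j + 1) j).hom w = 0),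
        (resComplex P).castX e (Θ.f n x) = w →
        cup P h (cycleClass P x hx hdx) (cycleClass P y hy hdy) = cycleClass P w hw hdw := by
  let g := (augmented P).liftCycles (i := m + 1)
    (pointHom (A := (augmented P).X (m + 1)) y hy) m (by simp) (pointHom_comp _ _ _ hdy)
  have hg : g ≫ (augmented P).iCycles (m + 1) = pointHom (A := (augmented P).X (m + 1)) y hy :=
    HomologicalComplex.liftCycles_i _ _ _ _ _
  obtain ⟨K, Θ, hK, hloop, hΘ, hKΘ⟩ := exists_loopPow_eq P g
  have hcomm : ∀ n, Θ (n + 1) ≫ (augmented P).d (m + 1 + n + 2) (m + 1 + n + 1) =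
      (augmented P).d (n + 2) (n + 1) ≫ Θ n := fun n => by
    rw [← HomologicalComplex.toCycles_i, ← HomologicalComplex.toCycles_i]
    have := hΘ (n + 1)
    have h2 := hKΘ n
    rw [Category.assoc, ← h2]
    exact (Category.assoc _ _ _).symm.trans ((congrArg (· ≫ _) this).trans (Category.assoc _ _ _))
  -- In the augmented indexing degree `0` is `ℤ`, so `d 1 0` is the augmentation and this reads `d
  -- Θ₀(c) = ε(c) y`.
  have hzero : Θ 0 ≫ (augmented P).d (m + 2) (m + 1) =
      (augmented P).d 1 0 ≫ pointHom (A := (augmented P).X (m + 1)) y hy := by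
    have h0 := hΘ 0
    rw [← HomologicalComplex.toCycles_i]
    refine (Category.assoc _ _ _).symm.trans ((congrArg (· ≫ _) h0).trans ?_)
    rw [hK, ← HomologicalComplex.toCycles_i]
    exact (congrArg ((augmented P).toCycles 1 0 ≫ ·) ((Category.assoc _ _ _).trans
      (congrArg ((augmented P).iCycles 0 ≫ ·) hg))).trans (Category.assoc _ _ _).symm
  refine ⟨⟨fun n => (Θ n).hom, fun n x => congr($(hcomm n).hom x)⟩,
    fun c => congr($(hzero).hom c), ?_⟩
  intro n j x hx hdx h e w hw hdw hΘw
  -- The `eqToHom` in the definition of `cup` now becomes an identity.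
  subst e
  refine (congrArg (fun t => StableHom.comp (StableHom.comp (cycleClass P x hx hdx) t) _)
    (hloop (n + 1))).trans (congrArg StableHom.mk ?_)
  rw [← cancel_mono ((augmented P).iCycles (m + 1 + n + 1)), HomologicalComplex.liftCycles_i]
  refine (congrArg (· ≫ (augmented P).iCycles (m + 1 + n + 1)) (Category.comp_id _)).trans ?_
  refine (Category.assoc _ _ _).trans ((congrArg (_ ≫ ·) (hKΘ n)).trans ?_)
  refine (Category.assoc _ _ _).symm.trans ((congrArg (· ≫ Θ n)
    (HomologicalComplex.liftCycles_i _ _ _ _ _)).trans ?_)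
  exact pointHom_comp_eq _ _ _ hΘw


/-- The product of the classes of `φ x` and `y` can be computed with any equivariant chain map from a
complex `C` of projective modules over `ℤ` which raises degrees and lifts `1 ↦ y`. -/
lemma cup_cycleClass [Fintype G] {C : RepComplex.{w} G} (hC : ∀ n, NormProjective (C.ρ n))
    (e : C.Aug) (φ : RepComplex.Hom C (resComplex P)) (hφ : ∀ x, (resAug P).ε (φ.f 0 x) = e.ε x)
    {m : ℕ} {y : P.complex.X m} (hy : ∀ g, (P.complex.X m).ρ g y = y)
    (hdy : ((augmented P).d (m + 1) m).hom y = 0)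
    (Λ : RepComplex.Hom C ((resComplex P).shift (m + 1)))
    (hΛ : ∀ c, (resComplex P).d m (Λ.f 0 c) = (pointHom (A := P.complex.X m) y hy).hom (e.ε c))
    {n j : ℕ} {z : C.X (n + 1)} (hz : ∀ g, C.ρ (n + 1) g z = z) (hdz : C.d n z = 0)
    {x : P.complex.X (n + 1)} (hxz : φ.f (n + 1) z = x)
    (hx : ∀ g, (P.complex.X (n + 1)).ρ g x = x)
    (hdx : ((augmented P).d (n + 2) (n + 1)).hom x = 0) (h : n + 2 + (m + 1) = j + 1)
    (hj : m + 1 + (n + 1) = j) {w : P.complex.X j} (hw : ∀ g, (P.complex.X j).ρ g w = w)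
    (hdw : ((augmented P).d (j + 1) j).hom w = 0)
    (hΛw : (resComplex P).castX hj (Λ.f (n + 1) z) = w) :
    cup P h (cycleClass P x hx hdx) (cycleClass P y hy hdy) = cycleClass P w hw hdw := by
  subst hj
  obtain ⟨Θ, hΘ, hcup⟩ := exists_cup_cycleClass P hy hdy
  have hw' : ∀ g, (P.complex.X (m + 1 + (n + 1))).ρ g (Θ.f (n + 1) x) = Θ.f (n + 1) x := fun g =>
    (Representation.IntertwiningMap.isIntertwining _ _ (Θ.f (n + 1)) g x).symm.trans (congrArg _ (hx g))
  have hdw' : ((augmented P).d (m + 1 + (n + 1) + 1) (m + 1 + (n + 1))).hom (Θ.f (n + 1) x) = 0 :=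
    (Θ.comm n x).trans ((congrArg _ hdx).trans (map_zero (Θ.f n)))
  rw [hcup hx hdx h rfl hw' hdw' rfl]
  refine (cycleClass_eq_iff P).2 ?_
  -- In degree zero `Θ φ` and `Λ` both have boundary `e.ε c • y`. Their difference therefore
  -- consists of cycles of degree `m + 1 > 0`, which bound, and the homotopy argument applies.
  obtain ⟨q, hq, hdq⟩ := RepComplex.exists_invariant_boundary hC
    ((resAug_exact P).exactPos.shift (m + 1)) ((Θ.comp φ).sub Λ) (fun c => by
      refine (resAug_exact P).exactPos m _ ?_
      refine (map_sub ((resComplex P).d m) (Θ.f 0 (φ.f 0 c)) (Λ.f 0 c)).trans ?_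
      exact sub_eq_zero.2 ((hΘ _).trans ((congrArg _ (hφ c)).trans (hΛ c).symm))) hz hdz
  refine ⟨q, hq, hdq.trans ?_⟩
  rw [RepComplex.Hom.sub_apply, RepComplex.Hom.comp_apply, hxz, ← hΛw]
  rfl

end Cup

/-! ### Independence of the resolution -/

section Independence

variable {G : Type} [Group G]

/-- The chain map of complexes of representations underlying a morphism of resolutions. -/
def resHom {P P' : ProjectiveResolution (Rep.trivial ℤ G ℤ)} (f : P.complex ⟶ P'.complex) :
    RepComplex.Hom (resComplex P) (resComplex P') where
  f n := (f.f n).hom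
  comm n x := congr($(f.comm (n + 1) n).hom x)

lemma exists_resolution_hom (P P' : ProjectiveResolution (Rep.trivial ℤ G ℤ)) :
    ∃ f : P.complex ⟶ P'.complex, f.f 0 ≫ P'.π.f 0 = P.π.f 0 := by
  refine ⟨ProjectiveResolution.lift (𝟙 _) P P', ?_⟩
  have := ProjectiveResolution.lift_commutes_zero (𝟙 _) P P'
  exact this.trans (Category.comp_id _)

variable [Fintype G]

/-- If the cup product of the images of `a` and `b` is the image of `c` for one resolution,
then it is so for every resolution. -/
lemma homologyToTate_eq_cup_of_eq {P P' : ProjectiveResolution (Rep.trivial ℤ G ℤ)} {n m : ℕ}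
    (hn : 0 < n) (hm : 0 < m) (h : n + 1 + (m + 1) = n + m + 1 + 1)
    {a : groupHomology (Rep.trivial ℤ G ℤ) n} {b : groupHomology (Rep.trivial ℤ G ℤ) m}
    {c : groupHomology (Rep.trivial ℤ G ℤ) (n + m + 1)}
    (hc : homologyToTate P (Nat.succ_pos (n + m)) c =
      cup P h (homologyToTate P hn a) (homologyToTate P hm b)) :
    homologyToTate P' (Nat.succ_pos (n + m)) c =
      cup P' h (homologyToTate P' hn a) (homologyToTate P' hm b) := by
  obtain ⟨f, hf⟩ := exists_resolution_hom P P'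
  obtain ⟨x, hx, hdx, hx', hdx', hPa, hP'a⟩ := homologyToTate_naturality f hf hn a
  obtain ⟨y, hy, hdy, hy', hdy', hPb, hP'b⟩ := homologyToTate_naturality f hf hm b
  obtain ⟨z, hz, hdz, hz', hdz', hPc, hP'c⟩ :=
    homologyToTate_naturality f hf (Nat.succ_pos (n + m)) c
  rw [hPa, hPb, hPc] at hc
  rw [hP'a, hP'b, hP'c]
  obtain ⟨n, rfl⟩ : ∃ l, n = l + 1 := ⟨n - 1, by omega⟩
  obtain ⟨Θ, hΘ, hcup⟩ := exists_cup_cycleClass P hy hdy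
  have hinv : ∀ g, (P.complex.X (m + 1 + (n + 1))).ρ g (Θ.f (n + 1) x) = Θ.f (n + 1) x := fun g =>
    (Representation.IntertwiningMap.isIntertwining _ _ (Θ.f (n + 1)) g x).symm.trans
      (congrArg _ (hx g))
  have hd0 : ((augmented P).d (m + 1 + (n + 1) + 1) (m + 1 + (n + 1))).hom (Θ.f (n + 1) x) = 0 :=
    (Θ.comm n x).trans ((congrArg _ hdx).trans (map_zero (Θ.f n)))
  -- The class `c` and `Θ x` live in degrees which are equal but not definitionally so; a free `j`
  -- allows substitution.
  have key : ∀ (j : ℕ) (e : m + 1 + (n + 1) = j) (h : n + 1 + 1 + (m + 1) = j + 1)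
      {z : P.complex.X j} (hz : ∀ g, (P.complex.X j).ρ g z = z)
      (hdz : ((augmented P).d (j + 1) j).hom z = 0)
      (hz' : ∀ g, (P'.complex.X j).ρ g ((f.f j).hom z) = (f.f j).hom z)
      (hdz' : ((augmented P').d (j + 1) j).hom ((f.f j).hom z) = 0),
      cycleClass P z hz hdz = cup P h (cycleClass P x hx hdx) (cycleClass P y hy hdy) →
      cycleClass P' ((f.f j).hom z) hz' hdz' =
        cup P' h (cycleClass P' _ hx' hdx') (cycleClass P' _ hy' hdy') := by
    rintro j rfl h z hz hdz hz' hdz' hc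
    obtain ⟨q, hq, hdq⟩ := (cycleClass_eq_iff P).1 (hc.trans (hcup hx hdx h rfl hinv hd0 rfl))
    have hfinv : ∀ g, (P'.complex.X (m + 1 + (n + 1))).ρ g ((f.f _).hom (Θ.f (n + 1) x)) =
        (f.f _).hom (Θ.f (n + 1) x) := fun g =>
      (Rep.hom_comm_apply (f.f _) g _).symm.trans (congrArg _ (hinv g))
    have hfd : ((augmented P').d (m + 1 + (n + 1) + 1) (m + 1 + (n + 1))).hom
        ((f.f _).hom (Θ.f (n + 1) x)) = 0 :=
      ((resHom f).comm (m + 1 + n) (Θ.f (n + 1) x)).trans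
        ((congrArg _ hd0).trans (map_zero (f.f (m + 1 + n)).hom))
    -- The composite `f Θ` satisfies `d (f Θ₀ c) = ε(c) f(y)`, so it computes the product over `P'`.
    let Λ : RepComplex.Hom (resComplex P) ((resComplex P').shift (m + 1)) :=
      { f := fun i => ((resHom f).f (m + 1 + i)).comp (Θ.f i)
        comm := fun i x => ((resHom f).comm (m + 1 + i) (Θ.f i.succ x)).trans
          (congrArg _ (Θ.comm i x)) }
    have hcup' := cup_cycleClass P' (resComplex_normProjective P) (resAug P) (resHom f)
      (fun x => congr($(hf).hom x)) hy' hdy' Λ (fun c => by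
        refine ((resHom f).comm m (Θ.f 0 c)).trans ((congrArg _ (hΘ c)).trans ?_)
        exact congr($(pointHom_comp_eq hy hy' (f.f m) rfl).hom _))
      hx hdx rfl hx' hdx' h rfl hfinv hfd rfl
    refine Eq.trans ((cycleClass_eq_iff P').2 ?_) hcup'.symm
    refine ⟨(f.f _).hom q, fun g => (Rep.hom_comm_apply (f.f _) g q).symm.trans
      (congrArg _ (hq g)), ?_⟩
    exact ((resHom f).comm _ q).trans ((congrArg (f.f _).hom hdq).trans (map_sub (f.f _).hom _ _))
  exact key _ (by omega) h hz hdz hz' hdz' hc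

/-- The product on group homology which corresponds to the cup product. -/
theorem exists_homology_product {n m : ℕ} (hn : 0 < n) (hm : 0 < m)
    (h : n + 1 + (m + 1) = n + m + 1 + 1) :
    ∃ μ : groupHomology (Rep.trivial ℤ G ℤ) n →+ groupHomology (Rep.trivial ℤ G ℤ) m →+
        groupHomology (Rep.trivial ℤ G ℤ) (n + m + 1),
      ∀ (P : ProjectiveResolution (Rep.trivial ℤ G ℤ))
        (a : groupHomology (Rep.trivial ℤ G ℤ) n) (b : groupHomology (Rep.trivial ℤ G ℤ) m),
        homologyToTate P (Nat.succ_pos (n + m)) (μ a b) =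
          cup P h (homologyToTate P hn a) (homologyToTate P hm b) := by
  let P : ProjectiveResolution (Rep.trivial ℤ G ℤ) := projectiveResolution _
  let e := AddEquiv.ofBijective (homologyToTate P (Nat.succ_pos (n + m)))
    (homologyToTate_bijective P _)
  refine ⟨(((cup P h).compl₂ (homologyToTate P hm)).comp (homologyToTate P hn)).compr₂
    e.symm.toAddMonoidHom, fun P' a b => homologyToTate_eq_cup_of_eq (P := P) hn hm h ?_⟩
  exact e.apply_symm_apply _

end Independence

/-! ### The singular complex -/

section SingularComplex

open Finsupp

universe u

/-- Removing two vertices in either order gives the same face with opposite signs; `(i, j) ↦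
(i.succAbove j, j.predAbove i)` is the involution exchanging the two orders. -/
lemma sum_alternating_faces_eq_zero {M : Type u} [AddCommGroup M] {n : ℕ}
    (T : (Fin (n + 1) → Fin (n + 3)) → M) :
    ∑ i : Fin (n + 3), ∑ j : Fin (n + 2),
      (-1 : ℤ) ^ (i + j : ℕ) • T (i.succAbove ∘ j.succAbove) = 0 := by
  rw [← Finset.sum_product', Finset.univ_product_univ]
  refine Finset.sum_ninvolution (fun p => (p.1.succAbove p.2, p.2.predAbove p.1)) ?_ ?_ ?_ ?_
  · rintro ⟨i, j⟩
    have : (i.succAbove j).succAbove ∘ (j.predAbove i).succAbove = i.succAbove ∘ j.succAbove :=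
      funext fun k => Fin.succAbove_succAbove_succAbove_predAbove i j k
    simp only [this, Fin.neg_one_pow_succAbove_add_predAbove, neg_smul]
    exact add_neg_cancel _
  · rintro ⟨i, j⟩ _ h
    exact Fin.succAbove_ne i j (congrArg Prod.fst h)
  · simp
  · rintro ⟨i, j⟩
    refine Prod.ext (Fin.succAbove_succAbove_predAbove i j) ?_
    exact Fin.predAbove_predAbove_succAbove i j

variable {G : Type} [Group G] {X Y : Type u} [TopologicalSpace X] [TopologicalSpace Y]

lemma singChain_hom_ext {M : Type*} [AddCommGroup M] {n : ℕ} {f g : SingChain X n →ₗ[ℤ] M}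
    (h : ∀ σ, f (single σ 1) = g (single σ 1)) : f = g :=
  lhom_ext' fun σ => LinearMap.ext_ring (h σ)

lemma boundary_single (n : ℕ) (σ : C(stdSimplex ℝ (Fin (n + 2)), X)) :
    boundary n (single σ 1) =
      ∑ i : Fin (n + 2), (-1 : ℤ) ^ (i : ℕ) • single (σ.comp (faceInclusion i)) (1 : ℤ) := by
  rw [boundary, linearCombination_single, one_smul]

lemma faceInclusion_comp {n : ℕ} (i : Fin (n + 3)) (j : Fin (n + 2)) :
    (faceInclusion i).comp (faceInclusion j) =
      ⟨stdSimplex.map (i.succAbove ∘ j.succAbove), stdSimplex.continuous_map _⟩ :=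
  ContinuousMap.ext fun x => stdSimplex.map_comp_apply _ _ x

lemma boundary_boundary (n : ℕ) (x : SingChain X (n + 2)) :
    boundary n (boundary (n + 1) x) = 0 := by
  suffices h : boundary n ∘ₗ boundary (n + 1) = (0 : SingChain X (n + 2) →ₗ[ℤ] _) from
    LinearMap.congr_fun h x
  refine singChain_hom_ext fun σ => ?_
  simp only [LinearMap.comp_apply, boundary_single, map_sum, map_smul, Finset.smul_sum, smul_smul,
    ← pow_add]
  have h := sum_alternating_faces_eq_zero fun f : Fin (n + 1) → Fin (n + 3) =>
    single (σ.comp ⟨stdSimplex.map f, stdSimplex.continuous_map _⟩) (1 : ℤ)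
  refine Eq.trans (Finset.sum_congr rfl fun i _ => Finset.sum_congr rfl fun j _ => ?_) h
  rw [ContinuousMap.comp_assoc, faceInclusion_comp]

lemma singAug_single (σ : C(stdSimplex ℝ (Fin 1), X)) : singAug (single σ 1) = 1 := by
  rw [singAug, linearCombination_single, one_smul]

lemma singAug_boundary (x : SingChain X 1) : singAug (boundary 0 x) = 0 := by
  suffices h : singAug ∘ₗ boundary 0 = (0 : SingChain X 1 →ₗ[ℤ] _) from LinearMap.congr_fun h x
  refine singChain_hom_ext fun σ => ?_
  simp [boundary_single, singAug_single, Fin.sum_univ_two]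

/-- The map on singular chains induced by a continuous map. -/
def chainMap (f : C(X, Y)) (n : ℕ) : SingChain X n →ₗ[ℤ] SingChain Y n :=
  lmapDomain ℤ ℤ fun σ => f.comp σ

lemma chainMap_single (f : C(X, Y)) {n : ℕ} (σ : C(stdSimplex ℝ (Fin (n + 1)), X)) :
    chainMap f n (single σ 1) = single (f.comp σ) 1 := mapDomain_single

lemma boundary_chainMap (f : C(X, Y)) (n : ℕ) (x : SingChain X (n + 1)) :
    boundary n (chainMap f (n + 1) x) = chainMap f n (boundary n x) := by
  suffices h : boundary n ∘ₗ chainMap f (n + 1) = chainMap f n ∘ₗ boundary n from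
    LinearMap.congr_fun h x
  refine singChain_hom_ext fun σ => ?_
  simp only [LinearMap.comp_apply, chainMap_single, boundary_single, map_sum, map_smul]
  rfl

lemma singAug_chainMap (f : C(X, Y)) (x : SingChain X 0) :
    singAug (chainMap f 0 x) = singAug x := by
  suffices h : singAug ∘ₗ chainMap f 0 = singAug from LinearMap.congr_fun h x
  refine singChain_hom_ext fun σ => ?_
  rw [LinearMap.comp_apply, chainMap_single, singAug_single, singAug_single]

variable [MulAction G X] [ContinuousConstSMul G X] [MulAction G Y]
  [ContinuousConstSMul G Y]

lemma chainMap_chainAct (f : C(X, Y)) (hf : ∀ (g : G) x, f (g • x) = g • f x) (g : G) (n : ℕ)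
    (x : SingChain X n) : chainMap f n (chainAct g n x) = chainAct g n (chainMap f n x) := by
  suffices h : chainMap f n ∘ₗ chainAct g n = chainAct g n ∘ₗ chainMap f n from
    LinearMap.congr_fun h x
  refine singChain_hom_ext fun σ => ?_
  change chainMap f n (chainMap _ n (single σ 1)) = chainMap _ n (chainMap f n (single σ 1))
  simp only [chainMap_single]
  exact congrArg (single · 1) (ContinuousMap.ext fun t => hf g (σ t))

lemma mem_invChains_iff {n : ℕ} {x : SingChain X n} :
    x ∈ invChains G X n ↔ ∀ g : G, chainAct g n x = x := by
  simp [invChains, Submodule.mem_iInf, LinearMap.mem_eqLocus]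

variable (G X)

/-- The representation of `G` on singular chains. -/
def singRep (n : ℕ) : Representation ℤ G (SingChain X n) where
  toFun g := chainAct g n
  map_one' := by
    refine singChain_hom_ext fun σ => ?_
    change chainMap _ n (single σ 1) = single σ 1
    rw [chainMap_single]
    exact congrArg (single · 1) (ContinuousMap.ext fun t => one_smul G (σ t))
  map_mul' g h := by
    refine singChain_hom_ext fun σ => ?_
    change chainMap _ n (single σ 1) = chainMap _ n (chainMap _ n (single σ 1))
    simp only [chainMap_single]
    exact congrArg (single · 1) (ContinuousMap.ext fun t => mul_smul g h (σ t))

/-- The singular complex of a `G`-space. -/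
def singComplex : RepComplex.{u} G where
  X n := SingChain X n
  ρ n := singRep G X n
  d n := ⟨boundary n, fun _ => LinearMap.ext fun x => boundary_chainMap _ n x⟩
  d_d n x := boundary_boundary n x

/-- The augmentation of the singular complex. -/
def singComplexAug : (singComplex G X).Aug where
  ε := ⟨singAug, fun _ => LinearMap.ext fun x => singAug_chainMap _ x⟩
  ε_d x := singAug_boundary x

variable {G X}

/-- The singular simplices form a free `G`-set: an element fixing `σ` fixes the point `σ` takes at a
vertex. -/
lemma singComplex_normProjective [Fintype G] [Nonempty X]
    (hX : ∀ (g : G) (x : X), g • x = x → g = 1) (n : ℕ) :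
    NormProjective ((singComplex G X).ρ n) :=
  NormProjective.of_free (S := C(stdSimplex ℝ (Fin (n + 1)), X)) (ρ := singRep G X n)
    (fun g σ h => hX g (σ (stdSimplex.vertex 0)) (DFunLike.congr_fun h _))
    (fun _ σ => (chainMap_single _ σ).trans rfl)

end SingularComplex

/-! ### Comparison maps -/

section Comparisons

universe u

variable {G : Type} [Group G] {X Y : Type u} [TopologicalSpace X] [MulAction G X]
  [ContinuousConstSMul G X] [TopologicalSpace Y] [MulAction G Y]
  [ContinuousConstSMul G Y] {P P' : ProjectiveResolution (Rep.trivial ℤ G ℤ)}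

/-- The morphism of complexes of representations given by a comparison map. -/
def Comparison.toHom (φ : Comparison X P) : RepComplex.Hom (singComplex G X) (resComplex P) where
  -- A comparison map is only additive, while the terms of `P` carry a `ℤ`-module structure of their
  -- own, which has to be identified with integer multiples.
  f n := ⟨⟨(φ.f n).toAddHom, fun c x =>
    (map_zsmul (φ.f n) c x).trans (int_smul_eq_zsmul ((resComplex P).module n) c _).symm⟩,
    fun g => LinearMap.ext fun x => φ.act n g x⟩
  comm n x := φ.comm n x

/-- The comparison map given by a morphism of complexes of representations. -/
def Comparison.ofHom (F : RepComplex.Hom (singComplex G X) (resComplex P))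
    (hF : ∀ x, (resAug P).ε (F.f 0 x) = singAug x) : Comparison X P where
  f n := (F.f n).toLinearMap.toAddMonoidHom
  act n g x := Representation.IntertwiningMap.isIntertwining _ _ (F.f n) g x
  comm n x := F.comm n x
  aug x := hF x

/-- Comparison maps can be restricted along equivariant maps. -/
def Comparison.pullback (φ : Comparison Y P) (f : C(X, Y)) (hf : ∀ (g : G) x, f (g • x) = g • f x) :
    Comparison X P where
  f n := (φ.f n).comp (chainMap f n).toAddMonoidHom
  act n g x := (congrArg (φ.f n) (chainMap_chainAct f hf g n x)).trans (φ.act n g _)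
  comm n x := (φ.comm n _).trans (congrArg (φ.f n) (boundary_chainMap f n x))
  aug x := (φ.aug _).trans (singAug_chainMap f x)

/-- Comparison maps can be composed with morphisms of resolutions. -/
def Comparison.postcomp (φ : Comparison X P) (f : P.complex ⟶ P'.complex)
    (hf : f.f 0 ≫ P'.π.f 0 = P.π.f 0) : Comparison X P' :=
  .ofHom ((resHom f).comp φ.toHom) (fun x => (congr($(hf).hom (φ.f 0 x))).trans (φ.aug x))

variable [Fintype G]

lemma nonempty_comparison [Nonempty X] (hX : ∀ (g : G) (x : X), g • x = x → g = 1)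
    (P : ProjectiveResolution (Rep.trivial ℤ G ℤ)) : Nonempty (Comparison X P) := by
  obtain ⟨F, hF⟩ := RepComplex.exists_augHom (singComplex_normProjective hX) (singComplexAug G X)
    (resAug_exact P)
  exact ⟨.ofHom F hF⟩

lemma Comparison.tateClass_eq [Nonempty X] (hX : ∀ (g : G) (x : X), g • x = x → g = 1)
    (φ φ' : Comparison X P) {n : ℕ} (z : invCycles G X (n + 1)) :
    φ.tateClass z = φ'.tateClass z := by
  refine (cycleClass_eq_iff P).2 ?_
  exact RepComplex.exists_invariant_boundary_sub (singComplex_normProjective hX)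
    (singComplexAug G X) (resAug_exact P) (F := φ.toHom) (F' := φ'.toHom) φ.aug φ'.aug
    (fun g => chainAct_of_mem z.2.1 g) z.2.2

/-- It is enough to check that a cycle represents a class with one comparison map. -/
lemma represents_of_tateClass_eq [Nonempty X] (hX : ∀ (g : G) (x : X), g • x = x → g = 1)
    (φ : Comparison X P) {n : ℕ} (hn : 0 < n) {z : invCycles G X n}
    {c : groupHomology (Rep.trivial ℤ G ℤ) n} (h : φ.tateClass z = homologyToTate P hn c) :
    Represents hn z c := by
  intro P'
  refine ⟨nonempty_comparison hX P', fun φ' => ?_⟩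
  obtain ⟨n, rfl⟩ : ∃ l, n = l + 1 := ⟨n - 1, by omega⟩
  obtain ⟨f, hf⟩ := exists_resolution_hom P P'
  -- All comparison maps into `P'` give the same class, so the given one may be replaced by `φ`
  -- followed by a morphism of resolutions.
  rw [φ'.tateClass_eq hX (φ.postcomp f hf)]
  obtain ⟨x, hx, hdx, hx', hdx', hP, hP'⟩ := homologyToTate_naturality f hf hn c
  rw [hP] at h
  rw [hP']
  obtain ⟨q, hq, hdq⟩ := (cycleClass_eq_iff P).1 h
  refine (cycleClass_eq_iff P').2 ⟨(f.f _).hom q, fun g =>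
    (Rep.hom_comm_apply (f.f _) g q).symm.trans (congrArg _ (hq g)), ?_⟩
  refine ((resHom f).comm _ q).trans ((congrArg (f.f _).hom hdq).trans ?_)
  exact map_sub (f.f (n + 1)).hom _ _

lemma existsUnique_represents [Nonempty X] (hX : ∀ (g : G) (x : X), g • x = x → g = 1)
    {n : ℕ} (hn : 0 < n) (z : invCycles G X n) : ∃! c, Represents hn z c := by
  let P : ProjectiveResolution (Rep.trivial ℤ G ℤ) := projectiveResolution _
  obtain ⟨φ⟩ := nonempty_comparison hX P
  obtain ⟨c, hc⟩ := (homologyToTate_bijective P hn).2 (φ.tateClass z)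
  refine ⟨c, represents_of_tateClass_eq hX φ hn hc.symm, fun c' hc' => ?_⟩
  exact (homologyToTate_bijective P hn).1 (((hc' P).2 φ).symm.trans hc.symm)

/-- For an acyclic free `G`-space every class is represented by an invariant cycle. -/
lemma exists_represents [Nonempty X] (hX : ∀ (g : G) (x : X), g • x = x → g = 1)
    (hE : (singComplexAug G X).Exact) {n : ℕ} (hn : 0 < n)
    (c : groupHomology (Rep.trivial ℤ G ℤ) n) : ∃ z : invCycles G X n, Represents hn z c := by
  let P : ProjectiveResolution (Rep.trivial ℤ G ℤ) := projectiveResolution _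
  obtain ⟨φ⟩ := nonempty_comparison hX P
  -- Exactness of the singular complex gives a chain map back from `P`. The representing cycle is
  -- the image under `ψ` of an invariant cycle `x` of `P`, and `φ ψ x` differs from `x` by an
  -- invariant boundary.
  obtain ⟨ψ, hψ⟩ := RepComplex.exists_augHom (resComplex_normProjective P) (resAug P) hE
  obtain ⟨n, rfl⟩ : ∃ l, n = l + 1 := ⟨n - 1, by omega⟩
  obtain ⟨x, hx, hd, hc⟩ := cycleClass_surjective P (homologyToTate P hn c)
  have hz : ψ.f (n + 1) x ∈ invCycles G X (n + 1) := by
    refine ⟨mem_invChains_iff.2 fun g => ?_, ?_⟩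
    · exact (Representation.IntertwiningMap.isIntertwining _ _ (ψ.f (n + 1)) g x).symm.trans
        (congrArg _ (hx g))
    · exact (ψ.comm n x).trans ((congrArg _ hd).trans (map_zero (ψ.f n)))
  refine ⟨⟨_, hz⟩, represents_of_tateClass_eq hX φ hn (Eq.trans ?_ hc)⟩
  refine (cycleClass_eq_iff P).2 ?_
  exact RepComplex.exists_invariant_boundary_sub (resComplex_normProjective P) (resAug P)
    (resAug_exact P) (F := φ.toHom.comp ψ) (F' := .id _) (fun y => (φ.aug _).trans (hψ y))
    (fun _ => rfl) hx hd

/-- If `φ z - φ z' = d q`, then `ψ q` bounds `ψ φ (z - z')`. The homotopy between `ψ φ` and the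
identity of the singular complex supplies the remaining invariant chain `v`. The converse applies
`φ` to the bounding chain. -/
lemma represents_same_iff [Nonempty X] (hX : ∀ (g : G) (x : X), g • x = x → g = 1)
    (hE : (singComplexAug G X).Exact) {n : ℕ} (hn : 0 < n) (z z' : invCycles G X n) :
    (∃ c, Represents hn z c ∧ Represents hn z' c) ↔
      ∃ w ∈ invChains G X (n + 1), boundary n w = (z : SingChain X n) - z' := by
  let P : ProjectiveResolution (Rep.trivial ℤ G ℤ) := projectiveResolution _
  obtain ⟨φ⟩ := nonempty_comparison hX P
  obtain ⟨n, rfl⟩ : ∃ l, n = l + 1 := ⟨n - 1, by omega⟩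
  constructor
  · rintro ⟨c, hz, hz'⟩
    obtain ⟨q, hq, hdq⟩ := (cycleClass_eq_iff P).1 (((hz P).2 φ).trans ((hz' P).2 φ).symm)
    obtain ⟨ψ, hψ⟩ := RepComplex.exists_augHom (resComplex_normProjective P) (resAug P) hE
    have hsub := (invCycles G X (n + 1)).sub_mem z.2 z'.2
    obtain ⟨v, hv, hdv⟩ := RepComplex.exists_invariant_boundary_sub (singComplex_normProjective hX)
      (singComplexAug G X) hE (F := .id _) (F' := ψ.comp φ.toHom) (fun _ => rfl)
      (fun y => (hψ _).trans (φ.aug y)) (fun g => chainAct_of_mem hsub.1 g) hsub.2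
    refine ⟨v + ψ.f (n + 2) q, Submodule.add_mem _ (mem_invChains_iff.2 hv)
      (mem_invChains_iff.2 fun g => ?_), ?_⟩
    · exact (Representation.IntertwiningMap.isIntertwining _ _ (ψ.f (n + 2)) g q).symm.trans
        (congrArg _ (hq g))
    · refine (map_add (boundary (n + 1)) v (ψ.f (n + 2) q)).trans ?_
      have h2 := (ψ.comm (n + 1) q).trans
        (congrArg _ (hdq.trans (map_sub (φ.f (n + 1)) _ _).symm))
      exact (congrArg₂ (· + ·) hdv h2).trans (sub_add_cancel _ _)
  · rintro ⟨v, hv, hdv⟩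
    obtain ⟨c, hc, -⟩ := existsUnique_represents hX hn z
    refine ⟨c, hc, represents_of_tateClass_eq hX φ hn (Eq.trans ?_ ((hc P).2 φ))⟩
    refine ((cycleClass_eq_iff P).2 ⟨φ.f (n + 2) v, fun g => ?_, ?_⟩).symm
    · rw [← φ.act, chainAct_of_mem hv]
    · exact (φ.comm (n + 1) v).trans ((congrArg _ hdv).trans (map_sub (φ.f (n + 1)) _ _))

end Comparisons

/-! ### The boundary of a join -/

section JoinBoundary

open Finsupp

universe u

/-- The inclusion of the vertices of the front face of `Δⁿ * Δᵐ`. -/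
def inlIdx {n m k : ℕ} (h : n + m + 1 = k) (j : Fin (n + 1)) : Fin (k + 1) := ⟨j, by omega⟩

/-- The inclusion of the vertices of the back face of `Δⁿ * Δᵐ`. -/
def inrIdx {n m k : ℕ} (h : n + m + 1 = k) (j : Fin (m + 1)) : Fin (k + 1) :=
  ⟨n + 1 + j, by omega⟩

/-- The `n + 1` front vertices precede the back ones, which shifts the sign of each back face by
`(-1)ⁿ⁺¹`. -/
lemma sum_alternating_split {M : Type*} [AddCommGroup M] {n m k : ℕ} (h : n + m + 1 = k)
    (F : Fin (k + 1) → M) :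
    ∑ i : Fin (k + 1), (-1 : ℤ) ^ (i : ℕ) • F i =
      ∑ j : Fin (n + 1), (-1 : ℤ) ^ (j : ℕ) • F (inlIdx h j) +
      (-1 : ℤ) ^ (n + 1) • ∑ j : Fin (m + 1), (-1 : ℤ) ^ (j : ℕ) • F (inrIdx h j) := by
  rw [← (finCongr (by omega : (n + 1) + (m + 1) = k + 1)).sum_comp, Fin.sum_univ_add,
    Finset.smul_sum]
  congr 1
  refine Finset.sum_congr rfl fun j _ => ?_
  rw [smul_smul, ← pow_add]
  rfl

/-- `joinCoord` with an arbitrary name for the dimension of the join. -/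
def joinCoordTo {n m k : ℕ} (h : n + m + 1 = k) :
    C(stdSimplex ℝ (Fin (n + 1)) × stdSimplex ℝ (Fin (m + 1)) × unitInterval,
      stdSimplex ℝ (Fin (k + 1))) := h ▸ joinCoord n m

lemma joinCoordTo_surjective {n m k : ℕ} (h : n + m + 1 = k) :
    Function.Surjective (joinCoordTo h) := by
  subst h
  exact joinCoord_surjective n m

lemma linearMap_apply_of_injective {ι κ : Type} [Fintype ι] [Fintype κ] {f : ι → κ}
    (hf : Function.Injective f) (x : ι → ℝ) (i : ι) :
    FunOnFinite.linearMap ℝ ℝ f x (f i) = x i := by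
  classical
  rw [FunOnFinite.linearMap_apply_apply, Finset.sum_eq_single i]
  · intro j hj hji
    exact absurd (hf (Finset.mem_filter.1 hj).2) hji
  · simp

lemma linearMap_apply_of_notMem {ι κ : Type} [Fintype ι] [Fintype κ] {f : ι → κ} (x : ι → ℝ)
    {k : κ} (hk : ∀ i, f i ≠ k) : FunOnFinite.linearMap ℝ ℝ f x k = 0 := by
  classical
  rw [FunOnFinite.linearMap_apply_apply]
  exact Finset.sum_eq_zero fun i hi => absurd (Finset.mem_filter.1 hi).2 (hk i)

/-- With join coordinates written as push-forwards along maps of vertices, the face identities below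
reduce to identities between maps of finite index sets. -/
lemma joinCoordTo_coe {n m k : ℕ} (h : n + m + 1 = k) (x : stdSimplex ℝ (Fin (n + 1)))
    (y : stdSimplex ℝ (Fin (m + 1))) (t : unitInterval) :
    (joinCoordTo h (x, y, t)).1 = (1 - t : ℝ) • FunOnFinite.linearMap ℝ ℝ (inlIdx h) x.1 +
      (t : ℝ) • FunOnFinite.linearMap ℝ ℝ (inrIdx h) y.1 := by
  subst h
  have hl : Function.Injective (inlIdx (rfl : n + m + 1 = _)) := fun i j hij =>
    Fin.ext (Fin.mk.inj hij)
  have hr : Function.Injective (inrIdx (rfl : n + m + 1 = _)) := fun i j hij =>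
    Fin.ext (Nat.add_left_cancel (Fin.mk.inj hij))
  funext i
  obtain ⟨i, rfl⟩ := (finCongr (by omega : (n + 1) + (m + 1) = n + m + 1 + 1)).surjective i
  refine Fin.addCases (fun j => ?_) (fun j => ?_) i
  · refine (joinCoordFun_left _ _ _ j).trans ?_
    have h1 := linearMap_apply_of_injective hl x.1 j
    have h2 := linearMap_apply_of_notMem (f := inrIdx (rfl : n + m + 1 = _)) y.1
      (k := inlIdx rfl j) (fun i hi => by
        have := congrArg Fin.val hi
        simp only [inlIdx, inrIdx] at this
        omega)
    change _ = (1 - t : ℝ) * FunOnFinite.linearMap ℝ ℝ (inlIdx rfl) x.1 (inlIdx rfl j) +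
      (t : ℝ) * FunOnFinite.linearMap ℝ ℝ (inrIdx rfl) y.1 (inlIdx rfl j)
    rw [h1, h2, mul_zero, add_zero]
    rfl
  · refine (joinCoordFun_right _ _ _ j).trans ?_
    have h1 := linearMap_apply_of_injective hr y.1 j
    have h2 := linearMap_apply_of_notMem (f := inlIdx (rfl : n + m + 1 = _)) x.1
      (k := inrIdx rfl j) (fun i hi => by
        have := congrArg Fin.val hi
        simp only [inlIdx, inrIdx] at this
        omega)
    change _ = (1 - t : ℝ) * FunOnFinite.linearMap ℝ ℝ (inlIdx rfl) x.1 (inrIdx rfl j) +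
      (t : ℝ) * FunOnFinite.linearMap ℝ ℝ (inrIdx rfl) y.1 (inrIdx rfl j)
    rw [h1, h2, mul_zero, zero_add]
    rfl

lemma faceInclusion_coe {n : ℕ} (i : Fin (n + 2)) (x : stdSimplex ℝ (Fin (n + 1))) :
    (faceInclusion i x).1 = FunOnFinite.linearMap ℝ ℝ i.succAbove x.1 := rfl

lemma linearMap_linearMap {a b c : ℕ} (f : Fin a → Fin b) (g : Fin b → Fin c) (x : Fin a → ℝ) :
    FunOnFinite.linearMap ℝ ℝ g (FunOnFinite.linearMap ℝ ℝ f x) =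
      FunOnFinite.linearMap ℝ ℝ (g ∘ f) x := by
  rw [FunOnFinite.linearMap_comp]
  rfl

lemma face_inl_joinCoordTo {n m k : ℕ} (h : n + 1 + m + 1 = k + 1) (h' : n + m + 1 = k)
    (j : Fin (n + 2)) (x : stdSimplex ℝ (Fin (n + 1))) (y : stdSimplex ℝ (Fin (m + 1)))
    (t : unitInterval) :
    faceInclusion (inlIdx h j) (joinCoordTo h' (x, y, t)) =
      joinCoordTo h (faceInclusion j x, y, t) := by
  refine Subtype.ext ?_
  have h1 : (inlIdx h j).succAbove ∘ inlIdx h' = inlIdx h ∘ j.succAbove := by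
    funext l
    ext
    simp only [inlIdx, Function.comp, Fin.succAbove, Fin.lt_def, Fin.val_castSucc]
    split_ifs <;> rfl
  have h2 : (inlIdx h j).succAbove ∘ inrIdx h' = inrIdx h := by
    funext l
    ext
    simp only [inlIdx, inrIdx, Function.comp, Fin.succAbove, Fin.lt_def, Fin.val_castSucc]
    split_ifs <;> simp only [Fin.val_succ, Fin.val_castSucc] <;> omega
  rw [faceInclusion_coe, joinCoordTo_coe, joinCoordTo_coe, map_add, map_smul, map_smul,
    linearMap_linearMap, linearMap_linearMap, faceInclusion_coe, linearMap_linearMap, h1, h2]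

lemma face_inr_joinCoordTo {n m k : ℕ} (h : n + (m + 1) + 1 = k + 1) (h' : n + m + 1 = k)
    (j : Fin (m + 2)) (x : stdSimplex ℝ (Fin (n + 1))) (y : stdSimplex ℝ (Fin (m + 1)))
    (t : unitInterval) :
    faceInclusion (inrIdx h j) (joinCoordTo h' (x, y, t)) =
      joinCoordTo h (x, faceInclusion j y, t) := by
  refine Subtype.ext ?_
  have h1 : (inrIdx h j).succAbove ∘ inlIdx h' = inlIdx h := by
    funext l
    ext
    simp only [inlIdx, inrIdx, Function.comp, Fin.succAbove, Fin.lt_def, Fin.val_castSucc]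
    split_ifs
    simp only [Fin.val_castSucc]
    omega
  have h2 : (inrIdx h j).succAbove ∘ inrIdx h' = inrIdx h ∘ j.succAbove := by
    funext l
    ext
    simp only [inrIdx, Function.comp, Fin.succAbove, Fin.lt_def, Fin.val_castSucc]
    split_ifs <;> simp only [Fin.val_succ, Fin.val_castSucc] <;> omega
  rw [faceInclusion_coe, joinCoordTo_coe, joinCoordTo_coe, map_add, map_smul, map_smul,
    linearMap_linearMap, linearMap_linearMap, faceInclusion_coe, linearMap_linearMap, h1, h2]

/-- Removing the only front vertex leaves the back face, where `t = 1` and the front coordinate `x`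
is irrelevant. -/
lemma face_inl_eq_joinCoordTo {k : ℕ} (h : 0 + k + 1 = k + 1) (j : Fin 1)
    (x : stdSimplex ℝ (Fin 1)) (y : stdSimplex ℝ (Fin (k + 1))) :
    faceInclusion (inlIdx h j) y = joinCoordTo h (x, y, 1) := by
  refine Subtype.ext ?_
  have h1 : (inlIdx h j).succAbove = inrIdx h := by
    funext l
    ext
    simp only [inlIdx, inrIdx, Fin.succAbove, Fin.lt_def, Fin.val_castSucc]
    split_ifs <;> simp only [Fin.val_succ, Fin.val_castSucc] <;> omega
  rw [faceInclusion_coe, joinCoordTo_coe, h1]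
  simp

lemma face_inr_eq_joinCoordTo {k : ℕ} (h : k + 0 + 1 = k + 1) (j : Fin 1)
    (x : stdSimplex ℝ (Fin (k + 1))) (y : stdSimplex ℝ (Fin 1)) :
    faceInclusion (inrIdx (n := k) (m := 0) h j) x = joinCoordTo (n := k) (m := 0) h (x, y, 0) := by
  refine Subtype.ext ?_
  have h1 : (inrIdx (n := k) (m := 0) h j).succAbove = inlIdx (n := k) (m := 0) h := by
    funext l
    ext
    simp only [inlIdx, inrIdx, Fin.succAbove, Fin.lt_def, Fin.val_castSucc]
    split_ifs
    simp only [Fin.val_castSucc]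
    omega
  rw [faceInclusion_coe, joinCoordTo_coe, h1]
  simp

variable {A B : Type u} [TopologicalSpace A] [TopologicalSpace B]

/-- The inclusion of the first factor of a join. -/
def TopJoin.inl (b : B) : C(A, TopJoin A B) :=
  TopJoin.proj.comp ⟨fun a => (a, b, 0), by fun_prop⟩

/-- The inclusion of the second factor of a join. -/
def TopJoin.inr (a : A) : C(B, TopJoin A B) :=
  TopJoin.proj.comp ⟨fun b => (a, b, 1), by fun_prop⟩

lemma TopJoin.proj_zero (a : A) (b b' : B) :
    TopJoin.proj (a, b, 0) = TopJoin.proj (a, b', 0) :=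
  Quotient.sound (s := joinSetoid A B) ⟨rfl, fun _ => rfl, fun h => absurd rfl h⟩

lemma TopJoin.proj_one (a a' : A) (b : B) :
    TopJoin.proj (a, b, 1) = TopJoin.proj (a', b, 1) :=
  Quotient.sound (s := joinSetoid A B) ⟨rfl, fun h => absurd rfl h, fun _ => rfl⟩

/-- `joinSimplex` with an arbitrary name for the dimension of the join. -/
def joinSimplexTo {n m k : ℕ} (h : n + m + 1 = k) (σ : C(stdSimplex ℝ (Fin (n + 1)), A))
    (τ : C(stdSimplex ℝ (Fin (m + 1)), B)) : C(stdSimplex ℝ (Fin (k + 1)), TopJoin A B) :=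
  h ▸ joinSimplex σ τ

lemma joinSimplexTo_apply {n m k : ℕ} (h : n + m + 1 = k) (σ : C(stdSimplex ℝ (Fin (n + 1)), A))
    (τ : C(stdSimplex ℝ (Fin (m + 1)), B)) (x : stdSimplex ℝ (Fin (n + 1)))
    (y : stdSimplex ℝ (Fin (m + 1))) (t : unitInterval) :
    joinSimplexTo h σ τ (joinCoordTo h (x, y, t)) = TopJoin.proj (σ x, τ y, t) := by
  subst h
  exact joinSimplex_apply σ τ x y t

lemma joinSimplexTo_unique {n m k : ℕ} (h : n + m + 1 = k) {σ : C(stdSimplex ℝ (Fin (n + 1)), A)}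
    {τ : C(stdSimplex ℝ (Fin (m + 1)), B)} {f : C(stdSimplex ℝ (Fin (k + 1)), TopJoin A B)}
    (hf : ∀ x y t, f (joinCoordTo h (x, y, t)) = TopJoin.proj (σ x, τ y, t)) :
    f = joinSimplexTo h σ τ := by
  refine ContinuousMap.ext fun p => ?_
  obtain ⟨⟨x, y, t⟩, rfl⟩ := joinCoordTo_surjective h p
  rw [hf, joinSimplexTo_apply]

/-- `joinChain` with an arbitrary name for the dimension of the join. -/
def joinChainTo {n m k : ℕ} (h : n + m + 1 = k) :
    SingChain A n →ₗ[ℤ] SingChain B m →ₗ[ℤ] SingChain (TopJoin A B) k := h ▸ joinChain n m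

lemma joinChainTo_single {n m k : ℕ} (h : n + m + 1 = k) (σ : C(stdSimplex ℝ (Fin (n + 1)), A))
    (τ : C(stdSimplex ℝ (Fin (m + 1)), B)) :
    joinChainTo h (single σ 1) (single τ 1) = single (joinSimplexTo h σ τ) 1 := by
  subst h
  simp only [joinChainTo, joinChain, linearCombination_single, one_smul]
  rfl

lemma joinChainTo_ext {M : Type*} [AddCommGroup M] {n m : ℕ}
    {f g : SingChain A n →ₗ[ℤ] SingChain B m →ₗ[ℤ] M}
    (h : ∀ σ τ, f (single σ 1) (single τ 1) = g (single σ 1) (single τ 1)) (x : SingChain A n)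
    (y : SingChain B m) : f x y = g x y := by
  have : f = g := singChain_hom_ext fun σ => singChain_hom_ext fun τ => h σ τ
  rw [this]

lemma boundary_joinSimplexTo {n m k : ℕ} (h : n + m + 1 = k + 1)
    (σ : C(stdSimplex ℝ (Fin (n + 1)), A)) (τ : C(stdSimplex ℝ (Fin (m + 1)), B)) :
    boundary k (joinChainTo h (single σ 1) (single τ 1)) =
      ∑ j : Fin (n + 1), (-1 : ℤ) ^ (j : ℕ) •
        single ((joinSimplexTo h σ τ).comp (faceInclusion (inlIdx h j))) (1 : ℤ) +
      (-1 : ℤ) ^ (n + 1) • ∑ j : Fin (m + 1), (-1 : ℤ) ^ (j : ℕ) •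
        single ((joinSimplexTo h σ τ).comp (faceInclusion (inrIdx h j))) (1 : ℤ) := by
  rw [joinChainTo_single, boundary_single]
  exact sum_alternating_split h fun i =>
    single ((joinSimplexTo h σ τ).comp (faceInclusion i)) (1 : ℤ)

lemma sum_front_faces {n m k : ℕ} (h : n + 1 + m + 1 = k + 1) (h' : n + m + 1 = k)
    (σ : C(stdSimplex ℝ (Fin (n + 2)), A)) (τ : C(stdSimplex ℝ (Fin (m + 1)), B)) :
    ∑ j : Fin (n + 2), (-1 : ℤ) ^ (j : ℕ) •
        single ((joinSimplexTo h σ τ).comp (faceInclusion (inlIdx h j))) (1 : ℤ) =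
      joinChainTo h' (boundary n (single σ 1)) (single τ 1) := by
  rw [boundary_single, map_sum, LinearMap.sum_apply]
  refine Finset.sum_congr rfl fun j _ => ?_
  rw [map_smul, LinearMap.smul_apply, joinChainTo_single]
  refine congrArg (fun s => (-1 : ℤ) ^ (j : ℕ) • single s (1 : ℤ))
    (joinSimplexTo_unique h' fun x y t => ?_)
  rw [ContinuousMap.comp_apply, face_inl_joinCoordTo h h', joinSimplexTo_apply]
  rfl

lemma sum_back_faces {n m k : ℕ} (h : n + (m + 1) + 1 = k + 1) (h' : n + m + 1 = k)
    (σ : C(stdSimplex ℝ (Fin (n + 1)), A)) (τ : C(stdSimplex ℝ (Fin (m + 2)), B)) :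
    ∑ j : Fin (m + 2), (-1 : ℤ) ^ (j : ℕ) •
        single ((joinSimplexTo h σ τ).comp (faceInclusion (inrIdx h j))) (1 : ℤ) =
      joinChainTo h' (single σ 1) (boundary m (single τ 1)) := by
  rw [boundary_single, map_sum]
  refine Finset.sum_congr rfl fun j _ => ?_
  rw [map_smul, joinChainTo_single]
  refine congrArg (fun s => (-1 : ℤ) ^ (j : ℕ) • single s (1 : ℤ))
    (joinSimplexTo_unique h' fun x y t => ?_)
  rw [ContinuousMap.comp_apply, face_inr_joinCoordTo h h', joinSimplexTo_apply]
  rfl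

lemma sum_front_faces_zero {k : ℕ} (h : 0 + k + 1 = k + 1) (a : A)
    (σ : C(stdSimplex ℝ (Fin 1), A)) (τ : C(stdSimplex ℝ (Fin (k + 1)), B)) :
    ∑ j : Fin 1, (-1 : ℤ) ^ (j : ℕ) •
        single ((joinSimplexTo h σ τ).comp (faceInclusion (inlIdx h j))) (1 : ℤ) =
      chainMap (TopJoin.inr a) k (single τ 1) := by
  rw [Fin.sum_univ_one, Fin.val_zero, pow_zero, one_smul, chainMap_single]
  refine congrArg (single · (1 : ℤ)) (ContinuousMap.ext fun y => ?_)
  rw [ContinuousMap.comp_apply, face_inl_eq_joinCoordTo h 0 (stdSimplex.vertex 0) y,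
    joinSimplexTo_apply]
  exact TopJoin.proj_one _ _ _

lemma sum_back_faces_zero {k : ℕ} (h : k + 0 + 1 = k + 1) (b : B)
    (σ : C(stdSimplex ℝ (Fin (k + 1)), A)) (τ : C(stdSimplex ℝ (Fin 1), B)) :
    ∑ j : Fin 1, (-1 : ℤ) ^ (j : ℕ) •
        single ((joinSimplexTo (n := k) (m := 0) h σ τ).comp (faceInclusion (inrIdx (n := k) (m := 0) h j))) (1 : ℤ) =
      chainMap (TopJoin.inl b) k (single σ 1) := by
  rw [Fin.sum_univ_one, Fin.val_zero, pow_zero, one_smul, chainMap_single]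
  refine congrArg (single · (1 : ℤ)) (ContinuousMap.ext fun x => ?_)
  rw [ContinuousMap.comp_apply, face_inr_eq_joinCoordTo h 0 x (stdSimplex.vertex 0),
    joinSimplexTo_apply]
  exact TopJoin.proj_zero _ _ _

/-- The Leibniz rule for joins; the exponent `n + 2` counts the vertices of a simplex of `x`. When a
factor has degree zero, its boundary is replaced by the augmentation, hence the separate cases
below. -/
theorem boundary_joinChainTo {n m k : ℕ} (h : n + 1 + (m + 1) + 1 = k + 1)
    (h₁ : n + (m + 1) + 1 = k) (h₂ : n + 1 + m + 1 = k) (x : SingChain A (n + 1))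
    (y : SingChain B (m + 1)) :
    boundary k (joinChainTo h x y) = joinChainTo h₁ (boundary n x) y +
      (-1 : ℤ) ^ (n + 2) • joinChainTo h₂ x (boundary m y) := by
  refine joinChainTo_ext (f := (joinChainTo h).compr₂ (boundary k))
    (g := (joinChainTo h₁).comp (boundary n) + (-1 : ℤ) ^ (n + 2) •
      (joinChainTo h₂).compl₂ (boundary m)) (fun σ τ => ?_) x y
  exact (boundary_joinSimplexTo h σ τ).trans (congrArg₂ (· + (-1 : ℤ) ^ (n + 2) • ·)
    (sum_front_faces h h₁ σ τ) (sum_back_faces h h₂ σ τ))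

/-- Removing the vertex leaves `y` in the second factor. The point `a` is arbitrary because the
first coordinate is forgotten at `t = 1`. -/
theorem boundary_joinChainTo_zero_left {m : ℕ} (h : 0 + (m + 1) + 1 = m + 1 + 1)
    (h₂ : 0 + m + 1 = m + 1) (a : A) (x : SingChain A 0) (y : SingChain B (m + 1)) :
    boundary (m + 1) (joinChainTo h x y) = singAug x • chainMap (TopJoin.inr a) (m + 1) y -
      joinChainTo h₂ x (boundary m y) := by
  refine joinChainTo_ext (f := (joinChainTo h).compr₂ (boundary (m + 1)))
    (g := (LinearMap.lsmul ℤ _).compl₂ (chainMap (TopJoin.inr a) (m + 1)) ∘ₗ singAug -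
      (joinChainTo h₂).compl₂ (boundary m)) (fun σ τ => ?_) x y
  refine (boundary_joinSimplexTo h σ τ).trans (Eq.trans (congrArg₂ (· + (-1 : ℤ) ^ (0 + 1) • ·)
    (sum_front_faces_zero h a σ τ) (sum_back_faces h h₂ σ τ)) ?_)
  change _ = singAug (single σ 1) • chainMap (TopJoin.inr a) (m + 1) (single τ 1) -
    joinChainTo h₂ (single σ 1) (boundary m (single τ 1))
  rw [singAug_single, one_smul, show (-1 : ℤ) ^ (0 + 1) = -1 from rfl, neg_one_smul,
    ← sub_eq_add_neg]

theorem boundary_joinChainTo_zero_right {n : ℕ} (h : n + 1 + 0 + 1 = n + 1 + 1)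
    (h₁ : n + 0 + 1 = n + 1) (b : B) (x : SingChain A (n + 1)) (τ : C(stdSimplex ℝ (Fin 1), B)) :
    boundary (n + 1) (joinChainTo (n := n + 1) (m := 0) h x (single τ 1)) =
      joinChainTo (n := n) (m := 0) h₁ (boundary n x) (single τ 1) +
      (-1 : ℤ) ^ (n + 2) • chainMap (TopJoin.inl b) (n + 1) x := by
  suffices hl : boundary (n + 1) ∘ₗ (joinChainTo (n := n + 1) (m := 0) h).flip (single τ 1) =
      (joinChainTo (n := n) (m := 0) h₁).flip (single τ 1) ∘ₗ boundary n +
        LinearMap.lsmul ℤ _ ((-1 : ℤ) ^ (n + 2)) ∘ₗ chainMap (TopJoin.inl b) (n + 1) from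
    LinearMap.congr_fun hl x
  refine singChain_hom_ext fun σ => ?_
  exact (boundary_joinSimplexTo (n := n + 1) (m := 0) h σ τ).trans (congrArg₂ (· + (-1 : ℤ) ^ (n + 2) • ·)
    (sum_front_faces (n := n) (m := 0) h h₁ σ τ) (sum_back_faces_zero h b σ τ))

theorem boundary_joinChainTo_zero_zero (h : 0 + 0 + 1 = 0 + 1) (a : A) (b : B) (x : SingChain A 0)
    (τ : C(stdSimplex ℝ (Fin 1), B)) :
    boundary 0 (joinChainTo h x (single τ 1)) =
      singAug x • chainMap (TopJoin.inr a) 0 (single τ 1) - chainMap (TopJoin.inl b) 0 x := by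
  suffices hl : boundary 0 ∘ₗ (joinChainTo h).flip (single τ 1) =
      (LinearMap.toSpanSingleton ℤ _ (chainMap (TopJoin.inr a) 0 (single τ 1))) ∘ₗ singAug -
        chainMap (TopJoin.inl b) 0 from LinearMap.congr_fun hl x
  refine singChain_hom_ext fun σ => ?_
  refine (boundary_joinSimplexTo h σ τ).trans (Eq.trans (congrArg₂ (· + (-1 : ℤ) ^ (0 + 1) • ·)
    (sum_front_faces_zero h a σ τ) (sum_back_faces_zero h b σ τ)) ?_)
  change _ = singAug (single σ 1) • chainMap (TopJoin.inr a) 0 (single τ 1) -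
    chainMap (TopJoin.inl b) 0 (single σ 1)
  rw [singAug_single, one_smul, show (-1 : ℤ) ^ (0 + 1) = -1 from rfl, neg_one_smul,
    ← sub_eq_add_neg]

variable {G : Type} [Group G] [MulAction G A] [ContinuousConstSMul G A] [MulAction G B]
  [ContinuousConstSMul G B]

lemma chainAct_joinChainTo {n m k : ℕ} (h : n + m + 1 = k) (g : G) (x : SingChain A n)
    (y : SingChain B m) :
    chainAct g k (joinChainTo h x y) = joinChainTo h (chainAct g n x) (chainAct g m y) := by
  refine joinChainTo_ext (f := (joinChainTo h).compr₂ (chainAct g k))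
    (g := (joinChainTo h).compl₁₂ (chainAct g n) (chainAct g m)) (fun σ τ => ?_) x y
  change chainMap _ k (joinChainTo h (single σ 1) (single τ 1)) =
    joinChainTo h (chainMap _ n (single σ 1)) (chainMap _ m (single τ 1))
  simp only [chainMap_single, joinChainTo_single]
  refine congrArg (single · (1 : ℤ)) (joinSimplexTo_unique h fun x y t => ?_)
  exact congrArg (g • ·) (joinSimplexTo_apply h σ τ x y t)

end JoinBoundary

/-! ### Contractible spaces -/

section Contractible

open Finsupp Topology

universe u

variable {A B : Type u} [TopologicalSpace A] [TopologicalSpace B]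

lemma TopJoin.isQuotientMap_proj : IsQuotientMap (TopJoin.proj (A := A) (B := B)) :=
  isQuotientMap_quotient_mk'

/-- A family of homotopies on `A × B × [0, 1]` compatible with the join relation descends. -/
lemma TopJoin.exists_homotopy_lift {f₀ f₁ : C(TopJoin A B, TopJoin A B)}
    (H : C(unitInterval × A × B × unitInterval, TopJoin A B))
    (hH : ∀ s p q, TopJoin.proj p = TopJoin.proj (A := A) (B := B) q → H (s, p) = H (s, q))
    (h₀ : ∀ p, H (0, p) = f₀ (TopJoin.proj p)) (h₁ : ∀ p, H (1, p) = f₁ (TopJoin.proj p)) :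
    f₀.Homotopic f₁ := by
  let F : unitInterval × TopJoin A B → TopJoin A B := fun x =>
    Quotient.lift (s := joinSetoid A B) (fun p => H (x.1, p))
      (fun p q h => hH x.1 p q (Quotient.sound (s := joinSetoid A B) h)) x.2
  have hF : Continuous F := by
    -- The interval is locally compact, so its product with a quotient map is again a quotient map.
    refine TopJoin.isQuotientMap_proj.continuous_lift_prod_right (g := F) ?_
    exact H.continuous
  refine ⟨⟨⟨F, hF⟩, fun x => ?_, fun x => ?_⟩⟩
  · obtain ⟨p, rfl⟩ := TopJoin.isQuotientMap_proj.surjective x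
    exact h₀ p
  · obtain ⟨p, rfl⟩ := TopJoin.isQuotientMap_proj.surjective x
    exact h₁ p

lemma TopJoin.proj_eq_iff {p q : A × B × unitInterval} :
    TopJoin.proj p = TopJoin.proj q ↔
      p.2.2 = q.2.2 ∧ (p.2.2 ≠ 1 → p.1 = q.1) ∧ (p.2.2 ≠ 0 → p.2.1 = q.2.1) :=
  Quotient.eq (r := joinSetoid A B)

/-- First the contraction of `A` acts on the `A`-coordinate at every level `t`, then `t` is scaled
to `0`. The first homotopy respects the relation since at `t = 1` the moved coordinate is ignored;
the second because the `A`-coordinate is by then constant and `t = 0` stays fixed. -/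
theorem TopJoin.contractibleSpace [ContractibleSpace A] [Nonempty B] :
    ContractibleSpace (TopJoin A B) := by
  rw [contractible_iff_id_nullhomotopic]
  obtain ⟨a₀, ⟨K⟩⟩ := id_nullhomotopic A
  obtain ⟨b₀⟩ := ‹Nonempty B›
  have hK0 : ∀ a, K (0, a) = a := fun a => K.apply_zero a
  have hK1 : ∀ a, K (1, a) = a₀ := fun a => K.apply_one a
  let r : C(A × B × unitInterval, TopJoin A B) :=
    TopJoin.proj.comp ⟨fun p : A × B × unitInterval => (a₀, p.2), by fun_prop⟩
  have hr : ∀ p q, TopJoin.proj p = TopJoin.proj q → r p = r q := fun p q h => by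
    obtain ⟨h1, -, h3⟩ := TopJoin.proj_eq_iff.1 h
    exact TopJoin.proj_eq_iff.2 ⟨h1, fun _ => rfl, h3⟩
  let f : C(TopJoin A B, TopJoin A B) := TopJoin.isQuotientMap_proj.lift r hr
  have hf : ∀ p, f (TopJoin.proj p) = TopJoin.proj (a₀, p.2) := fun p =>
    congr($(TopJoin.isQuotientMap_proj.lift_comp r hr) p)
  refine ⟨TopJoin.proj (a₀, b₀, 0), .trans (g := f) ?_ ?_⟩
  · refine TopJoin.exists_homotopy_lift
      (TopJoin.proj.comp ⟨fun x => (K (x.1, x.2.1), x.2.2), by fun_prop⟩) ?_ ?_ ?_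
    · intro s p q h
      obtain ⟨h1, h2, h3⟩ := TopJoin.proj_eq_iff.1 h
      exact TopJoin.proj_eq_iff.2 ⟨h1, fun h => by simp [h2 h], h3⟩
    · intro p
      simp [hK0]
    · intro p
      simp [hK1, hf]
  · refine TopJoin.exists_homotopy_lift (TopJoin.proj.comp
      ⟨fun x => (a₀, x.2.2.1, unitInterval.symm x.1 * x.2.2.2), by fun_prop⟩) ?_ ?_ ?_
    · intro s p q h
      obtain ⟨h1, h2, h3⟩ := TopJoin.proj_eq_iff.1 h
      refine TopJoin.proj_eq_iff.2 ⟨by simp [h1], fun _ => rfl, fun h => h3 fun h0 => h ?_⟩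
      simp [h0]
    · intro p
      simp [hf]
    · intro p
      simpa using TopJoin.proj_zero _ _ _

lemma TopJoin.eq_one_of_smul_eq {G : Type} [Group G] [MulAction G A] [MulAction G B]
    (hA : ∀ (g : G) (a : A), g • a = a → g = 1) (hB : ∀ (g : G) (b : B), g • b = b → g = 1)
    (g : G) (p : TopJoin A B) (h : g • p = p) : g = 1 := by
  obtain ⟨⟨a, b, t⟩, rfl⟩ := TopJoin.isQuotientMap_proj.surjective p
  rw [TopJoin.smul_proj, TopJoin.proj_eq_iff] at h
  by_cases ht : t = 1
  · exact hB g b (h.2.2 (by simp [ht]))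
  · exact hA g a (h.2.1 ht)

/-- The augmented singular complex of a contractible space is exact. -/
theorem singComplexAug_exact {G : Type} [Group G] [MulAction G A] [ContinuousConstSMul G A]
    [ContractibleSpace A] : (singComplexAug G A).Exact := by
  obtain ⟨p, ⟨K⟩⟩ := id_nullhomotopic A
  -- The join with a point is the cone on `A`. A contraction is constant at time `1`, so it descends
  -- to a retraction of the cone onto `A`, and coning off a cycle gives a chain that bounds it.
  let F : C(TopJoin A PUnit.{u + 1}, A) := TopJoin.isQuotientMap_proj.lift
    ⟨fun x => K (x.2.2, x.1), by fun_prop⟩ (by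
      rintro ⟨a, x, t⟩ ⟨b, y, t'⟩ h
      obtain ⟨h1, h2, -⟩ := TopJoin.proj_eq_iff.1 h
      obtain rfl : t = t' := h1
      by_cases ht : t = 1
      · change K (t, a) = K (t, b)
        rw [ht, K.apply_one, K.apply_one]
        rfl
      · obtain rfl : a = b := h2 ht
        rfl)
  have hF : F.comp (TopJoin.inl PUnit.unit) = ContinuousMap.id A := ContinuousMap.ext fun a =>
    (congr($(TopJoin.isQuotientMap_proj.lift_comp (f := TopJoin.proj (A := A) (B := PUnit.{u + 1}))
      _ _) (a, PUnit.unit, 0))).trans (K.apply_zero a)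
  have hF' : ∀ n (x : SingChain A n), chainMap F n (chainMap (TopJoin.inl PUnit.unit) n x) = x := by
    intro n x
    have : chainMap F n ∘ₗ chainMap (TopJoin.inl PUnit.unit) n = LinearMap.id := by
      refine singChain_hom_ext fun σ => ?_
      rw [LinearMap.comp_apply, chainMap_single, chainMap_single, ← ContinuousMap.comp_assoc, hF]
      rfl
    exact LinearMap.congr_fun this x
  let τ : C(stdSimplex ℝ (Fin 1), PUnit.{u + 1}) := ContinuousMap.const _ PUnit.unit
  -- The sign comes from `∂(x * pt) = ε(x) pt - x`.
  have h0 (x : SingChain A 0) (hx : singAug x = 0) :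
      boundary 0 (-chainMap F 1 (joinChainTo (k := 0 + 1) rfl x (single τ 1))) = x := by
    rw [map_neg, boundary_chainMap, boundary_joinChainTo_zero_zero rfl p PUnit.unit, hx, zero_smul,
      zero_sub, map_neg, neg_neg, hF']
  -- The scalar cancels the sign `(-1)ⁿ⁺²` of the base in the boundary of the cone.
  have h1 (n : ℕ) (x : SingChain A (n + 1)) (hx : boundary n x = 0) :
      boundary (n + 1) ((-1 : ℤ) ^ (n + 2) • chainMap F (n + 2)
        (joinChainTo (n := n + 1) (m := 0) (k := n + 1 + 1) rfl x (single τ 1))) = x := by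
    rw [map_smul, boundary_chainMap, boundary_joinChainTo_zero_right rfl rfl PUnit.unit, hx,
      map_zero, LinearMap.zero_apply, zero_add, map_smul, smul_smul, ← pow_add, hF',
      Even.neg_one_pow ⟨n + 2, rfl⟩, one_smul]
  refine ⟨fun c => ⟨c • single (ContinuousMap.const _ p) 1, ?_⟩, fun x hx => ⟨_, h0 x hx⟩,
    fun n x hx => ⟨_, h1 n x hx⟩⟩
  refine (map_smul singAug c _).trans ?_
  rw [singAug_single, smul_eq_mul, mul_one]

end Contractible

/-! ### The product of classes and the join of cycles -/

section JoinProduct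

universe u

variable {G : Type} [Group G] {E : Type u} [TopologicalSpace E] [MulAction G E]
  [ContinuousConstSMul G E]

lemma joinChain_mem_invCycles {n m : ℕ} {x : SingChain E (n + 1)} {y : SingChain E (m + 1)}
    (hx : x ∈ invCycles G E (n + 1)) (hy : y ∈ invCycles G E (m + 1)) :
    joinChain (n + 1) (m + 1) x y ∈ invCycles G (TopJoin E E) (n + 1 + (m + 1) + 1) := by
  have hdx : boundary n x = 0 := hx.2
  have hdy : boundary m y = 0 := hy.2
  refine ⟨mem_invChains_iff.2 fun g => ?_, ?_⟩
  · refine (chainAct_joinChainTo rfl g x y).trans ?_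
    rw [chainAct_of_mem hx.1, chainAct_of_mem hy.1]
    rfl
  · refine (boundary_joinChainTo (k := n + 1 + (m + 1)) rfl (by omega) (by omega) x y).trans ?_
    rw [hdx, hdy, map_zero, map_zero, LinearMap.zero_apply, smul_zero, add_zero]

lemma castX_joinChainTo {P : ProjectiveResolution (Rep.trivial ℤ G ℤ)} {A B : Type u}
    [TopologicalSpace A] [TopologicalSpace B]
    (f : ∀ k, SingChain (TopJoin A B) k →+ P.complex.X k) {n m k : ℕ} (h : n + m + 1 = k)
    (e : k = n + m + 1) (x : SingChain A n) (y : SingChain B m) :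
    (resComplex P).castX e (f k (joinChainTo h x y)) = f (n + m + 1) (joinChain n m x y) := by
  subst h
  rfl

/-- The chain map `c ↦ φ (c * y)` given by a comparison map `φ` on the join and an invariant
cycle `y`. -/
def joinHom {P : ProjectiveResolution (Rep.trivial ℤ G ℤ)} (φ : Comparison (TopJoin E E) P) {m : ℕ}
    {y : SingChain E (m + 1)} (hy : y ∈ invCycles G E (m + 1)) :
    RepComplex.Hom (singComplex G E) ((resComplex P).shift (m + 2)) where
  f j := ⟨(φ.toHom.f (m + 2 + j)).toLinearMap ∘ₗ
      (joinChainTo (by omega : j + (m + 1) + 1 = m + 2 + j)).flip y,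
    fun g => LinearMap.ext fun c => by
      refine (congrArg (φ.f (m + 2 + j)) ?_).trans (φ.act (m + 2 + j) g _)
      refine Eq.trans ?_ (chainAct_joinChainTo _ g c y).symm
      rw [chainAct_of_mem hy.1]
      rfl⟩
  comm j c := by
    have hdy : boundary m y = 0 := hy.2
    refine (φ.comm (m + 2 + j) _).trans (congrArg (φ.f (m + 2 + j)) ?_)
    -- With the cycle `y` on the right, the surviving term `∂c * y` has no sign, so no correction is
    -- needed to obtain a chain map.
    refine (boundary_joinChainTo (by omega) (by omega) (by omega) c y).trans ?_
    rw [hdy, map_zero, smul_zero, add_zero]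
    rfl

/-- The chain map `c ↦ φ(c * y)` satisfies the hypothesis of `cup_cycleClass` for the class of `y`,
and its value at `x` is `φ(x * y)`. -/
lemma cup_tateClass [Fintype G] [Nonempty E] (hE : ∀ (g : G) (e : E), g • e = e → g = 1)
    {P : ProjectiveResolution (Rep.trivial ℤ G ℤ)} (φ : Comparison (TopJoin E E) P) {n m : ℕ}
    (x : invCycles G E (n + 1)) (y : invCycles G E (m + 1))
    (ψ : Comparison E P) :
    φ.tateClass ⟨_, joinChain_mem_invCycles x.2 y.2⟩ =
      cup P (by omega) (ψ.tateClass x) (ψ.tateClass y) := by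
  obtain ⟨a⟩ := ‹Nonempty E›
  have : Nonempty E := ⟨a⟩
  -- The second factor sits equivariantly in the join, as the point `a` does not matter at `t = 1`.
  -- Both classes may be computed with the restriction of `φ` to it, which is the map occurring in
  -- the boundary of `c * y`.
  let φ' : Comparison E P := φ.pullback (TopJoin.inr a) fun g b => TopJoin.proj_one _ _ _
  rw [ψ.tateClass_eq hE φ', ψ.tateClass_eq hE φ']
  have hdy : boundary m (y : SingChain E (m + 1)) = 0 := y.2.2
  refine (cup_cycleClass P (singComplex_normProjective hE) (singComplexAug G E) φ'.toHom φ'.aug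
    (fun g => by rw [← φ'.act, chainAct_of_mem y.2.1]) (φ'.d_cycle y) (joinHom φ y.2) (fun c => ?_)
    (fun g => chainAct_of_mem x.2.1 g) x.2.2 rfl _ _ _ (by omega) _ _
    (castX_joinChainTo φ.f _ _ _ _)).symm
  refine (φ.comm (m + 1) _).trans ?_
  refine (congrArg (φ.f (m + 1)) (boundary_joinChainTo_zero_left _ (by omega) a c _)).trans ?_
  rw [hdy, map_zero, sub_zero, pointHom_apply, map_zsmul]
  exact (int_smul_eq_zsmul (P.complex.X (m + 1)).hV2 (singAug c) _).symm

/-- The join of invariant cycles represents the product of the classes. -/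
theorem represents_joinChain [Fintype G] [Nonempty E]
    (hE : ∀ (g : G) (e : E), g • e = e → g = 1) {n m : ℕ} (hn : 0 < n) (hm : 0 < m)
    (h : n + 1 + (m + 1) = n + m + 1 + 1) (x : invCycles G E n)
    (y : invCycles G E m) {a : groupHomology (Rep.trivial ℤ G ℤ) n}
    {b : groupHomology (Rep.trivial ℤ G ℤ) m} {c : groupHomology (Rep.trivial ℤ G ℤ) (n + m + 1)}
    (hc : ∀ P : ProjectiveResolution (Rep.trivial ℤ G ℤ),
      homologyToTate P (Nat.succ_pos (n + m)) c =
        cup P h (homologyToTate P hn a) (homologyToTate P hm b))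
    (hx : Represents hn x a) (hy : Represents hm y b) :
    ∃ h : joinChain n m (x : SingChain E n) (y : SingChain E m) ∈
        invCycles G (TopJoin E E) (n + m + 1),
      Represents (X := TopJoin E E) (Nat.succ_pos (n + m)) ⟨_, h⟩ c := by
  obtain ⟨n, rfl⟩ : ∃ l, n = l + 1 := ⟨n - 1, by omega⟩
  obtain ⟨m, rfl⟩ : ∃ l, m = l + 1 := ⟨m - 1, by omega⟩
  obtain ⟨e⟩ := ‹Nonempty E›
  have : Nonempty E := ⟨e⟩
  have : Nonempty (TopJoin E E) := ⟨TopJoin.proj (e, e, 0)⟩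
  refine ⟨joinChain_mem_invCycles x.2 y.2, fun P =>
    ⟨nonempty_comparison (TopJoin.eq_one_of_smul_eq hE hE) P, fun φ => ?_⟩⟩
  obtain ⟨⟨ψ⟩, hxψ⟩ := hx P
  rw [hc, ← hxψ ψ, ← (hy P).2 ψ]
  exact cup_tateClass hE φ x y ψ

end JoinProduct

end

end TateJoin

/-! ### The product on homology and its description by joins. -/

theorem mainTheorem2 (G : Type) [Group G] [Fintype G] (n m : ℕ) (hn : 0 < n) (hm : 0 < m) :
    (∀ (k : ℕ) (hk : 0 < k) (P : ProjectiveResolution (Rep.trivial ℤ G ℤ)),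
      Function.Bijective (homologyToTate P hk)) ∧
    ∃ μ : groupHomology (Rep.trivial ℤ G ℤ) n →+ groupHomology (Rep.trivial ℤ G ℤ) m →+
        groupHomology (Rep.trivial ℤ G ℤ) (n + m + 1),
      (∀ (P : ProjectiveResolution (Rep.trivial ℤ G ℤ))
        (a : groupHomology (Rep.trivial ℤ G ℤ) n) (b : groupHomology (Rep.trivial ℤ G ℤ) m),
        homologyToTate P (Nat.succ_pos (n + m)) (μ a b) =
          cup P (show (n + 1) + (m + 1) = n + m + 1 + 1 by omega)
            (homologyToTate P hn a) (homologyToTate P hm b)) ∧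
      ∀ (E : Type w) [TopologicalSpace E] [MulAction G E] [ContinuousConstSMul G E]
        [ContractibleSpace E], (∀ (g : G) (e : E), g • e = e → g = 1) →
        (∀ (k : ℕ) (hk : 0 < k),
          (∀ z : invCycles G E k, ∃! c, Represents hk z c) ∧
          (∀ c, ∃ z : invCycles G E k, Represents hk z c) ∧
          (∀ z z' : invCycles G E k, (∃ c, Represents hk z c ∧ Represents hk z' c) ↔
            ∃ w ∈ invChains G E (k + 1), boundary k w = (z : SingChain E k) - z')) ∧
        ContractibleSpace (TopJoin E E) ∧
        (∀ (g : G) (p : TopJoin E E), g • p = p → g = 1) ∧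
        ∀ (x : invCycles G E n) (y : invCycles G E m)
          (a : groupHomology (Rep.trivial ℤ G ℤ) n) (b : groupHomology (Rep.trivial ℤ G ℤ) m),
          Represents hn x a → Represents hm y b →
          ∃ h : joinChain n m (x : SingChain E n) (y : SingChain E m) ∈
              invCycles G (TopJoin E E) (n + m + 1),
            Represents (X := TopJoin E E) (Nat.succ_pos (n + m)) ⟨_, h⟩ (μ a b) := by
  obtain ⟨μ, hμ⟩ := exists_homology_product (G := G) hn hm (by omega)
  refine ⟨fun k hk P => homologyToTate_bijective P hk, μ, hμ, fun E _ _ _ _ hE => ?_⟩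
  have hE' := singComplexAug_exact (G := G) (A := E)
  refine ⟨fun k hk => ⟨existsUnique_represents hE hk, exists_represents hE hE' hk,
    represents_same_iff hE hE' hk⟩, TopJoin.contractibleSpace, TopJoin.eq_one_of_smul_eq hE hE,
    fun x y a b hx hy => represents_joinChain hE hn hm _ x y (fun P => hμ P a b) hx hy⟩
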